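/- **Conventions.** Points of $\mathbb R^d$, together with the points at infinity, are given by homogeneous coordinates in $\mathbb R^{d+1}$, an affine point $x$ being $[(x,1)]$. A hyperplane is given by a nonzero covector $h$, as $\{[v] : h\cdot v=0\}$. For points $[x]\ne[y]$ there are two closed line segments with these endpoints, $\{[ax+by] : a,b\ge 0,\ (a,b)\neq 0\}$ and the complementary one, obtained from $x$ and $-y$; if $[x]=[y]$ the segment is one point. A segment of more than one point crosses a hyperplane if it meets it (endpoints included); a one-point segment crosses nothing. The *crossing distance* between two flats in an arrangement of $n$ hyperplanes (a family; repetitions are allowed and counted with multiplicity) is the fewest hyperplanes crossed by any segment that has one endpoint on each flat. In particular, it is $0$ if the flats meet. The *regression depth* of a line $L\subset\mathbb R^3$ with respect to data points $q_1,\dots,q_n\in\mathbb R^3$ (first coordinate explanatory, the other two response variables) is the crossing distance, in the arrangement of the planes dual to the $q_i$, between the line dual to (the projective completion of) $L$ and the line at vertical infinity, i.e. the dual of the line at infinity of the plane spanned by the two response axes. Algorithms are deterministic programs for a real RAM: unit-cost exact operations $+,-,\times,/$ and comparisons on real numbers with rational constants, arrays with computed indices, and index arithmetic (sum, truncated difference,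 halving, comparison) on natural numbers; there is no rounding of reals to integers. **Theorem.** 1. For every fixed $d$ there is a deterministic real RAM program which, given $n$ hyperplanes (by nonzero covectors) and two lines (each by two linearly independent vectors spanning it) in homogeneous coordinates of $\mathbb R^d$, always halts and outputs the crossing distance between the two lines in the arrangement of these hyperplanes. Its worst-case running time $T(n)$ is $O(n\log n)$ as $n\to\infty$, with a constant that depends only on $d$. 2. There is a deterministic real RAM program which, given $n$ data points in $\mathbb R^3$ and a line in $\mathbb R^3$ (by two distinct points on it), always halts and outputs the regression depth of the line. Its worst-case running time is $O(n\log n)$. -/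

import Mathlib

open Filter Asymptotics Matrix

/-! ## Projective geometry of flats

Points of `ℝ^d`, together with the points at infinity, are the points of the projectivization
of `Fin (d + 1) → ℝ`; the affine point `x` has homogeneous coordinates `(x, 1)`.
A projective `k`-flat is a linear subspace of dimension `k + 1`. -/

namespace Arrangement

variable {d n : ℕ}

/-- Homogeneous coordinates of points (and of hyperplanes) of `ℝ^d`. -/
abbrev HVec (d : ℕ) : Type := Fin (d + 1) → ℝ

/-- Homogeneous coordinates `(x, 1)` of an affine point `x`. -/
def homog (x : Fin d → ℝ) : HVec d := Fin.snoc (α := fun _ => ℝ) x 1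

/-- The set of projective points that lie on the flat `F`. -/
def pointsOf (F : Submodule ℝ (HVec d)) : Set (Projectivization ℝ (HVec d)) :=
  {p | p.submodule ≤ F}

/-- The hyperplane with equation `h ⬝ᵥ v = 0` in homogeneous coordinates. The affine hyperplane
`{x | a ⬝ᵥ x + b = 0}` is the case `h = (a, b)`. -/
def hyperplane (h : HVec d) : Submodule ℝ (HVec d) where
  carrier := {v | h ⬝ᵥ v = 0}
  zero_mem' := dotProduct_zero h
  add_mem' := by
    intro v w hv hw
    simp only [Set.mem_ofPred_eq] at hv hw ⊢
    rw [dotProduct_add, hv, hw, add_zero]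
  smul_mem' := by
    intro c v hv
    simp only [Set.mem_ofPred_eq] at hv ⊢
    rw [dotProduct_smul, hv, smul_zero]

/-- The closed projective line segment, with endpoints `[x]` and `[y]`, that consists of the points
`[a x + b y]` with `a, b ≥ 0`. If `[x] ≠ [y]`, the endpoints cut the projective line through them
into two complementary segments, `seg x y` and `seg x (-y)`. If `[x] = [y]`, this is one point. -/
def seg (x y : HVec d) : Set (Projectivization ℝ (HVec d)) :=
  {p | ∃ a b : ℝ, 0 ≤ a ∧ 0 ≤ b ∧ ∃ h : a • x + b • y ≠ 0, p = Projectivization.mk ℝ (a • x + b • y) h}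

/-- A segment crosses a hyperplane if it meets it (endpoints included); a segment that is reduced to
a single point crosses nothing. -/
def Crosses (S : Set (Projectivization ℝ (HVec d))) (h : HVec d) : Prop :=
  S.Nontrivial ∧ (S ∩ pointsOf (hyperplane h)).Nonempty

/-- The number of hyperplanes of the arrangement `H` that the segment `S` crosses. -/
noncomputable def crossings (H : Fin n → HVec d) (S : Set (Projectivization ℝ (HVec d))) : ℕ :=
  {i : Fin n | Crosses S (H i)}.ncard

/-- The crossing distance between two flats in the arrangement of the hyperplanes with coordinates
`H i`: the fewest crossings along any segment having one endpoint on each flat. -/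
noncomputable def crossingDistance (H : Fin n → HVec d) (F₁ F₂ : Submodule ℝ (HVec d)) : ℕ :=
  sInf {m | ∃ x ∈ F₁, ∃ y ∈ F₂, x ≠ 0 ∧ y ≠ 0 ∧ m = crossings H (seg x y)}

/-- The projective dual of a flat: a point `[u]` of the dual space is the hyperplane `u ⬝ᵥ v = 0`,
and it belongs to the dual of `F` iff that hyperplane contains `F`. The dual of the point `[h]` is
`hyperplane h`. -/
def dualFlat (F : Submodule ℝ (HVec d)) : Submodule ℝ (HVec d) where
  carrier := {u | ∀ v ∈ F, u ⬝ᵥ v = 0}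
  zero_mem' := fun v _ => zero_dotProduct v
  add_mem' := by
    intro u w hu hw v hv
    rw [add_dotProduct, hu v hv, hw v hv, add_zero]
  smul_mem' := by
    intro c u hu v hv
    rw [smul_dotProduct, hu v hv, smul_zero]

/-- The projective completion of an affine subspace of `ℝ^d`. -/
def completion (L : AffineSubspace ℝ (Fin d → ℝ)) : Submodule ℝ (HVec d) :=
  Submodule.span ℝ (homog '' (L : Set (Fin d → ℝ)))

/-- The intersection of the hyperplane at infinity with the flat spanned by the axes of the
response variables, when the first `k` of the `d` coordinates are the explanatory variables and
the others are the response variables. -/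
def responseAtInfinity (d k : ℕ) : Submodule ℝ (HVec d) where
  carrier := {w | w (Fin.last d) = 0 ∧ ∀ i : Fin d, (i : ℕ) < k → w i.castSucc = 0}
  zero_mem' := ⟨rfl, fun _ _ => rfl⟩
  add_mem' := by
    rintro v w ⟨hv, hv'⟩ ⟨hw, hw'⟩
    exact ⟨by simp [hv, hw], fun i hi => by simp [hv' i hi, hw' i hi]⟩
  smul_mem' := by
    rintro c v ⟨hv, hv'⟩
    exact ⟨by simp [hv], fun i hi => by simp [hv' i hi]⟩

/-- The regression depth of a `k`-flat `L` with respect to the data points `pts`: the crossing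
distance, in the arrangement of the hyperplanes dual to the data points, between the dual of `L` and
the `k`-flat at vertical infinity. -/
noncomputable def regressionDepth (k : ℕ) (pts : Fin n → Fin d → ℝ)
    (L : AffineSubspace ℝ (Fin d → ℝ)) : ℕ :=
  crossingDistance (fun i => homog (pts i)) (dualFlat (completion L))
    (dualFlat (responseAtInfinity d k))

end Arrangement

/-! ## The real RAM

A deterministic random access machine with exact real arithmetic and unit cost per operation,
programmed in a structured language. Memory consists of arrays of natural numbers (used for counting
and for indices) and arrays of real numbers. The arrays are named by numerals that are fixed in the
program; indices are computed. There is no conversion from reals to integers, such as rounding. -/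

namespace RealRAM

/-- Contents of the memory: `nat A i` is entry `i` of the array of natural numbers with name `A`,
`real A i` is entry `i` of the array of real numbers with name `A`. -/
structure Memory where
  nat : ℕ → ℕ → ℕ
  real : ℕ → ℕ → ℝ

/-- Expressions of type `ℕ`. -/
inductive NatExpr where
  | const (k : ℕ)
  | get (A : ℕ) (i : NatExpr)
  | add (a b : NatExpr)
  | sub (a b : NatExpr)
  | half (a : NatExpr)

/-- Value of an expression; subtraction is truncated at zero, halves are rounded down. -/
def NatExpr.eval (s : Memory) : NatExpr → ℕ
  | const k => k
  | get A i => s.nat A (i.eval s)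
  | add a b => a.eval s + b.eval s
  | sub a b => a.eval s - b.eval s
  | half a => a.eval s / 2

/-- Number of operations needed to evaluate an expression. -/
def NatExpr.cost : NatExpr → ℕ
  | const _ => 1
  | get _ i => i.cost + 1
  | add a b => a.cost + b.cost + 1
  | sub a b => a.cost + b.cost + 1
  | half a => a.cost + 1

/-- Expressions of type `ℝ`; only rational constants are allowed. -/
inductive RealExpr where
  | const (q : ℚ)
  | get (A : ℕ) (i : NatExpr)
  | add (a b : RealExpr)
  | sub (a b : RealExpr)
  | mul (a b : RealExpr)
  | div (a b : RealExpr)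

/-- Value of an expression; a division by zero returns zero. -/
noncomputable def RealExpr.eval (s : Memory) : RealExpr → ℝ
  | const q => (q : ℝ)
  | get A i => s.real A (i.eval s)
  | add a b => a.eval s + b.eval s
  | sub a b => a.eval s - b.eval s
  | mul a b => a.eval s * b.eval s
  | div a b => a.eval s / b.eval s

/-- Number of operations needed to evaluate an expression. -/
def RealExpr.cost : RealExpr → ℕ
  | const _ => 1
  | get _ i => i.cost + 1
  | add a b => a.cost + b.cost + 1
  | sub a b => a.cost + b.cost + 1
  | mul a b => a.cost + b.cost + 1
  | div a b => a.cost + b.cost + 1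

/-- Tests. -/
inductive Cond where
  | natLt (a b : NatExpr)
  | realLt (a b : RealExpr)
  | not (c : Cond)
  | and (c e : Cond)

/-- Truth value of a test. -/
def Cond.Holds (s : Memory) : Cond → Prop
  | natLt a b => a.eval s < b.eval s
  | realLt a b => a.eval s < b.eval s
  | not c => ¬ c.Holds s
  | and c e => c.Holds s ∧ e.Holds s

/-- Number of operations needed to evaluate a test. -/
def Cond.cost : Cond → ℕ
  | natLt a b => a.cost + b.cost + 1
  | realLt a b => a.cost + b.cost + 1
  | not c => c.cost + 1
  | and c e => c.cost + e.cost + 1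

/-- Programs. -/
inductive Program where
  | skip
  | setNat (A : ℕ) (i e : NatExpr)
  | setReal (A : ℕ) (i : NatExpr) (e : RealExpr)
  | seq (P Q : Program)
  | ite (c : Cond) (P Q : Program)
  | while (c : Cond) (P : Program)

/-- The memory after the assignment `A[i] := v` for an array `A` of natural numbers. -/
def Memory.setNat (s : Memory) (A i v : ℕ) : Memory :=
  { s with nat := Function.update s.nat A (Function.update (s.nat A) i v) }

/-- The memory after the assignment `A[i] := v` for an array `A` of real numbers. -/
def Memory.setReal (s : Memory) (A i : ℕ) (v : ℝ) : Memory :=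
  { s with real := Function.update s.real A (Function.update (s.real A) i v) }

/-- `Runs P s s' t`: started with memory `s`, the program `P` halts after `t` steps, and then the
memory is `s'`. Each operation, test and assignment takes a step. -/
inductive Runs : Program → Memory → Memory → ℕ → Prop where
  | skip (s : Memory) : Runs .skip s s 1
  | setNat (A : ℕ) (i e : NatExpr) (s : Memory) :
      Runs (.setNat A i e) s (s.setNat A (i.eval s) (e.eval s)) (i.cost + e.cost + 1)
  | setReal (A : ℕ) (i : NatExpr) (e : RealExpr) (s : Memory) :
      Runs (.setReal A i e) s (s.setReal A (i.eval s) (e.eval s)) (i.cost + e.cost + 1)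
  | seq {P Q : Program} {s s' s'' : Memory} {t t' : ℕ} :
      Runs P s s' t → Runs Q s' s'' t' → Runs (.seq P Q) s s'' (t + t')
  | ite_true {c : Cond} {P Q : Program} {s s' : Memory} {t : ℕ} :
      c.Holds s → Runs P s s' t → Runs (.ite c P Q) s s' (c.cost + 1 + t)
  | ite_false {c : Cond} {P Q : Program} {s s' : Memory} {t : ℕ} :
      ¬ c.Holds s → Runs Q s s' t → Runs (.ite c P Q) s s' (c.cost + 1 + t)
  | while_true {c : Cond} {P : Program} {s s' s'' : Memory} {t t' : ℕ} :
      c.Holds s → Runs P s s' t → Runs (.while c P) s' s'' t' →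
      Runs (.while c P) s s'' (c.cost + 1 + t + t')
  | while_false {c : Cond} {P : Program} {s : Memory} :
      ¬ c.Holds s → Runs (.while c P) s s (c.cost + 1)

/-- Programs are deterministic: result and running time are determined by the input. -/
theorem Runs.unique {P : Program} {s s₁ s₂ : Memory} {t₁ t₂ : ℕ} (h₁ : Runs P s s₁ t₁)
    (h₂ : Runs P s s₂ t₂) : s₁ = s₂ ∧ t₁ = t₂ := by
  induction h₁ generalizing s₂ t₂ with
  | skip => cases h₂; exact ⟨rfl, rfl⟩
  | setNat => cases h₂; exact ⟨rfl, rfl⟩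
  | setReal => cases h₂; exact ⟨rfl, rfl⟩
  | seq _ _ ih ih' =>
    cases h₂ with
    | seq a b =>
      obtain ⟨rfl, rfl⟩ := ih a
      obtain ⟨rfl, rfl⟩ := ih' b
      exact ⟨rfl, rfl⟩
  | ite_true h _ ih =>
    cases h₂ with
    | ite_true _ a => obtain ⟨rfl, rfl⟩ := ih a; exact ⟨rfl, rfl⟩
    | ite_false h' _ => exact absurd h h'
  | ite_false h _ ih =>
    cases h₂ with
    | ite_true h' _ => exact absurd h' h
    | ite_false _ a => obtain ⟨rfl, rfl⟩ := ih a; exact ⟨rfl, rfl⟩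
  | while_true h _ _ ih ih' =>
    cases h₂ with
    | while_true _ a b =>
      obtain ⟨rfl, rfl⟩ := ih a
      obtain ⟨rfl, rfl⟩ := ih' b
      exact ⟨rfl, rfl⟩
    | while_false h' => exact absurd h h'
  | while_false h =>
    cases h₂ with
    | while_true h' _ _ => exact absurd h' h
    | while_false => exact ⟨rfl, rfl⟩

/-- A matrix stored row by row in an array, with zeros after its last entry. -/
def rowMajor {m w : ℕ} (M : Fin m → Fin w → ℝ) : ℕ → ℝ :=
  fun a => if h : a < m * w then M (Fin.divNat ⟨a, h⟩) (Fin.modNat ⟨a, h⟩) else 0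

/-- Initial memory: the number `n` in `nat 0 0`, the `m` rows that describe the flats in the array
`real 0`, the `n` rows that describe the hyperplanes or the data points in the array `real 1`, and
zero elsewhere. -/
def input {m n w : ℕ} (flats : Fin m → Fin w → ℝ) (rows : Fin n → Fin w → ℝ) : Memory where
  nat := fun A i => if A = 0 ∧ i = 0 then n else 0
  real := fun A => if A = 0 then rowMajor flats else if A = 1 then rowMajor rows else fun _ => 0

/-- On the initial memory `s`, the program `P` halts within `T` steps with the output `k`, which it
leaves in `nat 0 0`. -/
def Outputs (P : Program) (s : Memory) (T k : ℕ) : Prop :=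
  ∃ (s' : Memory) (t : ℕ), Runs P s s' t ∧ t ≤ T ∧ s'.nat 0 0 = k

end RealRAM

/-! Let the lines be spanned by u, u' and by v, v'. They meet iff the Gram determinant of the four
vectors vanishes (`det_gram_eq_zero_iff`), and then the distance is 0. Otherwise hyperplane i
restricts to a linear form f_i in the coefficients x ∈ ℝ² of a point of the first line and to a form
g_i in the coefficients y of a point of the second. The segment from x to y crosses it iff f_i(x)
g_i(y) ≤ 0 (`crosses_seg_iff`), and the complementary segment belongs to the pair x, -y. So
`crossCount` is to be minimized over all nonzero x, y (`crossingDistance_eq`).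

A small perturbation keeps every positive product positive, so it cannot increase the count, and one
may take x = (1, s), y = ε(1, t) with ε = ±1, where no form vanishes unless it is identically zero
(`exists_generic_le`). There the count is a constant minus ε/2 times the sum of sign f_i(1, s) ·
sign g_i(1, t) (`crossCount_generic`). The sum, `signSum`, is piecewise constant in s and t, and the
greatest value of its modulus gives the minimum (`isLeast_crossCount`).

That value is found by a sweep. For fixed s, the values for all t are a base value plus prefix sums
of the jumps at the sorted roots of the g_i. A complete binary tree that stores the sum and the
extreme prefix sums of each block shows the extremes at its root (`Loaded.greatest`). When s passes
a root of some f_i, one weight changes, hence one leaf and O(log n) nodes (`splitDiff_update`,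
`Spec.addWeight`). Coinciding roots must be passed together: equal roots of the g_i share a rank,
and the sweep queries only between different roots of the f_i (`Spec.sweep`). Sorting by a
tournament tree costs O(n log n), and the result, an integer at most n, is converted by counting up
(`Spec.convert`).

For the regression depth, both dual lines have explicit bases if the two given points differ in the
explanatory coordinate (`regressionDepth_eq`), and the same minimization applies; otherwise the dual
lines meet (`regressionDepth_eq_zero`). Correctness and running time are carried together by `Spec`.
-/

namespace RealRAM

/-! ### Memory access -/

@[simp] theorem Memory.setNat_real (s : Memory) (A i v : ℕ) : (s.setNat A i v).real = s.real := rfl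

@[simp] theorem Memory.setReal_nat (s : Memory) (A i : ℕ) (v : ℝ) :
    (s.setReal A i v).nat = s.nat := rfl

@[simp] theorem Memory.setNat_nat_self (s : Memory) (A i v : ℕ) :
    (s.setNat A i v).nat A = Function.update (s.nat A) i v := by
  simp [Memory.setNat]

@[simp] theorem Memory.setReal_real_self (s : Memory) (A i : ℕ) (v : ℝ) :
    (s.setReal A i v).real A = Function.update (s.real A) i v := by
  simp [Memory.setReal]

@[simp] theorem Memory.setNat_nat_of_ne (s : Memory) {A B : ℕ} (i v : ℕ) (h : B ≠ A) :
    (s.setNat A i v).nat B = s.nat B := by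
  simp [Memory.setNat, h]

@[simp] theorem Memory.setReal_real_of_ne (s : Memory) {A B : ℕ} (i : ℕ) (v : ℝ) (h : B ≠ A) :
    (s.setReal A i v).real B = s.real B := by
  simp [Memory.setReal, h]

attribute [simp] NatExpr.eval RealExpr.eval Cond.Holds

/-! ### Loop-free programs -/

/-- No `while` occurs in the program. -/
def Program.loopFree : Program → Bool
  | .seq P Q => P.loopFree && Q.loopFree
  | .ite _ P Q => P.loopFree && Q.loopFree
  | .while _ _ => false
  | _ => true

/-- The effect of a loop-free program. -/
noncomputable def Program.exec : Program → Memory → Memory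
  | .skip, s => s
  | .setNat A i e, s => s.setNat A (i.eval s) (e.eval s)
  | .setReal A i e, s => s.setReal A (i.eval s) (e.eval s)
  | .seq P Q, s => Q.exec (P.exec s)
  | .ite c P Q, s => open Classical in if c.Holds s then P.exec s else Q.exec s
  | .while _ _, s => s

/-- A bound for the running time of a loop-free program. -/
def Program.bound : Program → ℕ
  | .skip => 1
  | .setNat _ i e => i.cost + e.cost + 1
  | .setReal _ i e => i.cost + e.cost + 1
  | .seq P Q => P.bound + Q.bound
  | .ite c P Q => c.cost + 1 + (P.bound + Q.bound)
  | .while _ _ => 0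

attribute [simp] Program.loopFree Program.exec

theorem Program.runs_exec {P : Program} (h : P.loopFree = true) (s : Memory) :
    ∃ t, Runs P s (P.exec s) t ∧ t ≤ P.bound := by
  induction P generalizing s with
  | skip => exact ⟨_, .skip s, le_rfl⟩
  | setNat A i e => exact ⟨_, .setNat A i e s, le_rfl⟩
  | setReal A i e => exact ⟨_, .setReal A i e s, le_rfl⟩
  | seq P Q ihP ihQ =>
    simp only [loopFree, Bool.and_eq_true] at h
    obtain ⟨t, ht, hle⟩ := ihP h.1 s
    obtain ⟨t', ht', hle'⟩ := ihQ h.2 (P.exec s)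
    exact ⟨_, .seq ht ht', add_le_add hle hle'⟩
  | ite c P Q ihP ihQ =>
    simp only [loopFree, Bool.and_eq_true] at h
    by_cases hc : c.Holds s
    · obtain ⟨t, ht, hle⟩ := ihP h.1 s
      simp only [exec, hc, if_true]
      exact ⟨_, .ite_true hc ht, by simp only [bound]; lia⟩
    · obtain ⟨t, ht, hle⟩ := ihQ h.2 s
      simp only [exec, hc, if_false]
      exact ⟨_, .ite_false hc ht, by simp only [bound]; lia⟩
  | _ => simp at h

/-! ### Frames -/

/-- The arrays of natural numbers that a program assigns to. -/
def Program.natWrites : Program → List ℕ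
  | .setNat A _ _ => [A]
  | .seq P Q => P.natWrites ++ Q.natWrites
  | .ite _ P Q => P.natWrites ++ Q.natWrites
  | .while _ P => P.natWrites
  | _ => []

/-- The arrays of real numbers that a program assigns to. -/
def Program.realWrites : Program → List ℕ
  | .setReal A _ _ => [A]
  | .seq P Q => P.realWrites ++ Q.realWrites
  | .ite _ P Q => P.realWrites ++ Q.realWrites
  | .while _ P => P.realWrites
  | _ => []

attribute [simp] Program.natWrites Program.realWrites

theorem Runs.nat_eq {P : Program} {s s' : Memory} {t A : ℕ} (h : Runs P s s' t)
    (hA : A ∉ P.natWrites) : s'.nat A = s.nat A := by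
  induction h <;> simp_all

theorem Runs.real_eq {P : Program} {s s' : Memory} {t A : ℕ} (h : Runs P s s' t)
    (hA : A ∉ P.realWrites) : s'.real A = s.real A := by
  induction h <;> simp_all

theorem Program.exec_nat_eq {P : Program} {A : ℕ} (h : P.loopFree = true) (hA : A ∉ P.natWrites)
    (s : Memory) : (P.exec s).nat A = s.nat A := by
  obtain ⟨t, ht, -⟩ := P.runs_exec h s
  exact ht.nat_eq hA

theorem Program.exec_real_eq {P : Program} {A : ℕ} (h : P.loopFree = true)
    (hA : A ∉ P.realWrites) (s : Memory) : (P.exec s).real A = s.real A := by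
  obtain ⟨t, ht, -⟩ := P.runs_exec h s
  exact ht.real_eq hA

/-! ### Total correctness with running times -/

/-- Started with memory `s`, the program `P` halts within `T` steps, and then the memory
satisfies `Q`. -/
def Spec (P : Program) (s : Memory) (T : ℕ) (Q : Memory → Prop) : Prop :=
  ∃ (s' : Memory) (t : ℕ), Runs P s s' t ∧ t ≤ T ∧ Q s'

theorem Spec.mono {P : Program} {s : Memory} {T T' : ℕ} {Q Q' : Memory → Prop}
    (h : Spec P s T Q) (hT : T ≤ T') (hQ : ∀ s', Q s' → Q' s') : Spec P s T' Q' := by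
  obtain ⟨s', t, hr, ht, hq⟩ := h
  exact ⟨s', t, hr, ht.trans hT, hQ _ hq⟩

theorem Spec.seq {P Q : Program} {s : Memory} {T T' : ℕ} {R : Memory → Prop}
    (h : Spec P s T fun s' => Spec Q s' T' R) : Spec (.seq P Q) s (T + T') R := by
  obtain ⟨s', t, hr, ht, s'', t', hr', ht', hq⟩ := h
  exact ⟨s'', _, .seq hr hr', add_le_add ht ht', hq⟩

theorem Spec.exec {P : Program} {s : Memory} {Q : Memory → Prop} (h : P.loopFree = true)
    (hQ : Q (P.exec s)) : Spec P s P.bound Q := by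
  obtain ⟨t, ht, hle⟩ := P.runs_exec h s
  exact ⟨_, t, ht, hle, hQ⟩

theorem Spec.frame {P : Program} {s : Memory} {T : ℕ} {Q : Memory → Prop} (h : Spec P s T Q) :
    Spec P s T fun s' => Q s' ∧ (∀ A, A ∉ P.natWrites → s'.nat A = s.nat A) ∧
      ∀ A, A ∉ P.realWrites → s'.real A = s.real A := by
  obtain ⟨s', t, hr, ht, hq⟩ := h
  exact ⟨s', t, hr, ht, hq, fun A hA => hr.nat_eq hA, fun A hA => hr.real_eq hA⟩

theorem Spec.ite {c : Cond} {P Q : Program} {s : Memory} {T : ℕ} {R : Memory → Prop}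
    (hP : c.Holds s → Spec P s T R) (hQ : ¬ c.Holds s → Spec Q s T R) :
    Spec (.ite c P Q) s (c.cost + 1 + T) R := by
  by_cases hc : c.Holds s
  · obtain ⟨s', t, hr, ht, hq⟩ := hP hc
    exact ⟨s', _, .ite_true hc hr, by lia, hq⟩
  · obtain ⟨s', t, hr, ht, hq⟩ := hQ hc
    exact ⟨s', _, .ite_false hc hr, by lia, hq⟩

/-- The measure `μ` serves both for termination and as a bound for the number of rounds. -/
theorem Spec.while {c : Cond} {P : Program} {T : ℕ} (I : Memory → Prop) (μ : Memory → ℕ)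
    (h : ∀ s, I s → c.Holds s → Spec P s T fun s' => I s' ∧ μ s' < μ s) {s : Memory} (hs : I s) :
    Spec (.while c P) s (μ s * (c.cost + 1 + T) + (c.cost + 1))
      fun s' => I s' ∧ ¬ c.Holds s' := by
  induction hm : μ s using Nat.strong_induction_on generalizing s with
  | _ m ih =>
    by_cases hc : c.Holds s
    · obtain ⟨s', t, hr, ht, hi, hlt⟩ := h s hs hc
      obtain ⟨s'', t', hr', ht', hq⟩ := ih (μ s') (hm ▸ hlt) hi rfl
      refine ⟨s'', _, .while_true hc hr hr', ?_, hq⟩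
      have h1 : (μ s' + 1) * (c.cost + 1 + T) ≤ m * (c.cost + 1 + T) :=
        Nat.mul_le_mul_right _ (hm ▸ hlt)
      rw [add_mul] at h1
      lia
    · exact ⟨s, _, .while_false hc, by lia, hs, hc⟩

/-- Run `P` with the loop counter `nat A 0` going from `0` to `nat 0 0 - 1`. -/
def forLoop (A : ℕ) (P : Program) : Program :=
  .seq (.setNat A (.const 0) (.const 0))
    (.while (.natLt (.get A (.const 0)) (.get 0 (.const 0)))
      (.seq P (.setNat A (.const 0) (.add (.get A (.const 0)) (.const 1)))))

@[simp] theorem natWrites_forLoop (A : ℕ) (P : Program) :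
    (forLoop A P).natWrites = A :: (P.natWrites ++ [A]) := rfl

@[simp] theorem realWrites_forLoop (A : ℕ) (P : Program) :
    (forLoop A P).realWrites = P.realWrites := by simp [forLoop]

/-- The invariant is required in the memory whose counter has already been advanced, so that it may
mention the counter. The body may write neither the counter nor the bound `nat 0 0`. -/
theorem Spec.forLoop {A : ℕ} {P : Program} {T n : ℕ} (I : ℕ → Memory → Prop) (hA : A ≠ 0)
    (hPA : A ∉ P.natWrites) (hP0 : 0 ∉ P.natWrites)
    (h : ∀ k s, k < n → s.nat A 0 = k → s.nat 0 0 = n → I k s →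
      Spec P s T fun s' => I (k + 1) (s'.setNat A 0 (k + 1)))
    {s : Memory} (hn : s.nat 0 0 = n) (hs : I 0 (s.setNat A 0 0)) :
    Spec (RealRAM.forLoop A P) s (n * (T + 12) + 9) fun s' => I n s' := by
  have key : Spec (RealRAM.forLoop A P) s (n * (T + 12) + 9) fun s' =>
      (s'.nat 0 0 = n ∧ s'.nat A 0 ≤ n ∧ I (s'.nat A 0) s') ∧
        ¬ (Cond.natLt (.get A (.const 0)) (.get 0 (.const 0))).Holds s' := by
    refine (Spec.seq (T := 3) (T' := n * (T + 12) + 6) (Spec.exec rfl ?_)).mono (by lia) fun _ h => h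
    refine (Spec.while (T := T + 6) (fun s' => s'.nat 0 0 = n ∧ s'.nat A 0 ≤ n ∧ I (s'.nat A 0) s')
      (fun s' => n - s'.nat A 0) ?_ ?_).mono ?_ fun _ h => h
    · rintro s ⟨h0, hle, hI⟩ hc
      simp only [Cond.Holds, NatExpr.eval, h0] at hc
      refine Spec.seq ((h _ s hc rfl h0 hI).frame.mono le_rfl ?_)
      rintro s' ⟨hI', hN, -⟩
      have e1 := hN A hPA
      have e2 := hN 0 hP0
      refine Spec.exec rfl ?_
      simp only [Program.exec, NatExpr.eval, e1, hA.symm, ne_eq, not_false_eq_true,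
        Memory.setNat_nat_of_ne, Memory.setNat_nat_self, Function.update_self, e2]
      exact ⟨⟨h0, hc, hI'⟩, by lia⟩
    · simp [hA.symm, hn, hs]
    · simp [Cond.cost, NatExpr.cost]
      exact le_of_eq (by ring)
  refine key.mono le_rfl ?_
  rintro s' ⟨⟨h0, hle, hI⟩, hc⟩
  simp only [Cond.Holds, NatExpr.eval, h0, not_lt] at hc
  rwa [le_antisymm hle hc] at hI

end RealRAM

/-! ### Complete binary trees in arrays -/

/-- The nodes `1, …, 2 N - 1` form a tree in heap order with the leaves `L 0, …, L (N - 1)`, in which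
each inner node combines its children by `op`. -/
def IsTree {α : Type*} (op : α → α → α) (N : ℕ) (L nd : ℕ → α) : Prop :=
  (∀ k, 1 ≤ k → k < N → nd k = op (nd (k + k)) (nd (k + k + 1))) ∧ ∀ p, p < N → nd (N + p) = L p

/-- As `IsTree`, except that the proper ancestors of `j` may contain anything. -/
def IsTreeExcept {α : Type*} (op : α → α → α) (N : ℕ) (L nd : ℕ → α) (j : ℕ) : Prop :=
  j < N + N ∧
  (∀ k, 1 ≤ k → k < N → (∃ i, 1 ≤ i ∧ k = j / 2 ^ i) ∨ nd k = op (nd (k + k)) (nd (k + k + 1))) ∧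
  ∀ p, p < N → nd (N + p) = L p

/-- The combination of the `2 ^ h` consecutive leaves from `p` on. -/
def treeVal {α : Type*} (op : α → α → α) (L : ℕ → α) : ℕ → ℕ → α
  | 0, p => L p
  | h + 1, p => op (treeVal op L h p) (treeVal op L h (p + 2 ^ h))

section Tree

variable {α : Type*} {op : α → α → α} {N : ℕ} {L nd : ℕ → α}

/-- A new leaf can spoil the equation only at its parent. -/
theorem IsTree.update (h : IsTree op N L nd) {p : ℕ} (hp : p < N) (v : α) :
    IsTreeExcept op N (Function.update L p v) (Function.update nd (N + p) v) (N + p) := by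
  refine ⟨by lia, fun k h1 hk => ?_, fun q hq => ?_⟩
  · rw [Function.update_of_ne (by lia)]
    by_cases hc : k = (N + p) / 2
    · exact Or.inl ⟨1, le_rfl, by simpa using hc⟩
    · right
      rw [Function.update_of_ne (by lia), Function.update_of_ne (by lia)]
      exact h.1 k h1 hk
  · by_cases hqp : q = p
    · subst hqp; simp
    · rw [Function.update_of_ne (by lia), Function.update_of_ne hqp]
      exact h.2 q hq

/-- Recomputing the parent repairs its own equation, and the only other equation that involves its
value is that of the grandparent. -/
theorem IsTreeExcept.step {j : ℕ} (h : IsTreeExcept op N L nd j) (hj : 1 < j) :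
    IsTreeExcept op N L (Function.update nd (j / 2) (op (nd (j / 2 + j / 2)) (nd (j / 2 + j / 2 + 1))))
      (j / 2) := by
  obtain ⟨hN, h1, h2⟩ := h
  refine ⟨by lia, fun k hk hkN => ?_, fun p hp => ?_⟩
  · by_cases hkj : k = j / 2
    · right
      subst hkj
      rw [Function.update_self, Function.update_of_ne (by lia), Function.update_of_ne (by lia)]
    · by_cases hkj' : k = j / 2 / 2
      · exact Or.inl ⟨1, le_rfl, by simpa using hkj'⟩
      · rw [Function.update_of_ne hkj, Function.update_of_ne (by lia),
          Function.update_of_ne (by lia)]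
        refine (h1 k hk hkN).imp_left ?_
        rintro ⟨i, hi, rfl⟩
        obtain ⟨i, rfl⟩ := Nat.exists_eq_add_of_le' hi
        refine ⟨i, ?_, by rw [Nat.div_div_eq_div_mul, pow_succ']⟩
        by_contra hi0
        obtain rfl : i = 0 := by lia
        simp at hkj
  · rw [Function.update_of_ne (by lia)]
    exact h2 p hp

theorem IsTreeExcept.isTree {j : ℕ} (h : IsTreeExcept op N L nd j) (hj : j ≤ 1) :
    IsTree op N L nd := by
  refine ⟨fun k hk hkN => (h.2.1 k hk hkN).resolve_left ?_, h.2.2⟩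
  rintro ⟨i, hi, rfl⟩
  have : j / 2 ^ i = 0 := Nat.div_eq_of_lt (hj.trans_lt (Nat.one_lt_two_pow (by lia)))
  lia

/-- The nodes of height `l` are numbered from `2 ^ (K - l)` on, and the node at offset `m` lies
above the block of `2 ^ l` leaves that starts at `m * 2 ^ l`. -/
theorem IsTree.eq_treeVal {K : ℕ} (h : IsTree op (2 ^ K) L nd) (l m : ℕ) (hl : l ≤ K)
    (hm : m < 2 ^ (K - l)) : nd (2 ^ (K - l) + m) = treeVal op L l (m * 2 ^ l) := by
  induction l generalizing m with
  | zero => simpa [treeVal] using h.2 m hm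
  | succ l ih =>
    have e : 2 ^ (K - l) = 2 ^ (K - (l + 1)) + 2 ^ (K - (l + 1)) := by
      rw [← mul_two, ← pow_succ]; congr 1; lia
    have hpos : 0 < 2 ^ (K - (l + 1)) := by positivity
    have hle : 2 ^ (K - l) ≤ 2 ^ K := Nat.pow_le_pow_right (by lia) (by lia)
    rw [h.1 _ (by lia) (by lia), treeVal]
    have h1 := ih (m + m) (by lia) (by lia)
    have h2 := ih (m + m + 1) (by lia) (by lia)
    congr 1
    · rw [show 2 ^ (K - (l + 1)) + m + (2 ^ (K - (l + 1)) + m) = 2 ^ (K - l) + (m + m) by lia, h1]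
      congr 1; ring
    · rw [show 2 ^ (K - (l + 1)) + m + (2 ^ (K - (l + 1)) + m) + 1 = 2 ^ (K - l) + (m + m + 1) by lia,
        h2]
      congr 1; ring

theorem IsTree.root_eq {K : ℕ} (h : IsTree op (2 ^ K) L nd) : nd 1 = treeVal op L K 0 := by
  simpa using h.eq_treeVal K 0 le_rfl (by simp)

end Tree

/-! ### Repairing a tree along the path from a leaf to the root. -/

namespace RealRAM

/-- Replace the pointer `nat 4 0` by the program `C`, which moves it to the parent and recomputes
that node, until the root is reached. -/
def walkUp (C : Program) : Program := .while (.natLt (.const 1) (.get 4 (.const 0))) C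

/-- Halving the pointer lowers its binary logarithm by one, and a pointer below `2 * N` has
logarithm at most `K`; hence at most `K` rounds. -/
theorem Spec.walkUp {α : Type*} {op : α → α → α} {N K : ℕ} (hN : N = 2 ^ K) {L : ℕ → α}
    {C : Program} (nd : Memory → ℕ → α) (I : Memory → Prop) (hC : C.loopFree = true)
    (hI : ∀ s, I s → I (C.exec s)) (hj : ∀ s, (C.exec s).nat 4 0 = s.nat 4 0 / 2)
    (hnd : ∀ s, I s → nd (C.exec s) = Function.update (nd s) (s.nat 4 0 / 2)
      (op (nd s (s.nat 4 0 / 2 + s.nat 4 0 / 2)) (nd s (s.nat 4 0 / 2 + s.nat 4 0 / 2 + 1))))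
    {s : Memory} (hs : I s) (ht : IsTreeExcept op N L (nd s) (s.nat 4 0)) :
    Spec (RealRAM.walkUp C) s ((K + 1) * (C.bound + 5)) fun s' => IsTree op N L (nd s') := by
  have hlog : Nat.log 2 (s.nat 4 0) ≤ K := by
    refine Nat.lt_succ_iff.mp (Nat.log_lt_of_lt_pow' (by lia) ?_)
    rw [pow_succ, ← hN]; have := ht.1; lia
  refine (Spec.while (T := C.bound) (fun s => I s ∧ IsTreeExcept op N L (nd s) (s.nat 4 0))
    (fun s => Nat.log 2 (s.nat 4 0)) ?_ ⟨hs, ht⟩).mono ?_ ?_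
  · rintro s ⟨hs, ht⟩ hc
    simp only [Cond.Holds, NatExpr.eval] at hc
    refine Spec.exec hC ⟨⟨hI s hs, ?_⟩, ?_⟩
    · rw [hj, hnd s hs]
      exact ht.step hc
    · have := Nat.log_pos (b := 2) (by lia) hc
      rw [hj, Nat.log_div_base]
      lia
  · simp only [Cond.cost, NatExpr.cost]
    calc _ ≤ K * (1 + (1 + 1) + 1 + 1 + C.bound) + (1 + (1 + 1) + 1 + 1) :=
          Nat.add_le_add_right (Nat.mul_le_mul_right _ hlog) _
      _ ≤ _ := by ring_nf; lia
  · rintro s' ⟨⟨-, h⟩, hc⟩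
    simp only [Cond.Holds, NatExpr.eval, not_lt] at hc
    exact h.isTree hc

end RealRAM

/-! ### Tournament trees -/

/-- The better one of two entries of a tournament tree; `0` stands for no entry, and `i + 1` for an
item with key `key i`. -/
noncomputable def minEntry (key : ℕ → ℝ) (l r : ℕ) : ℕ :=
  open Classical in if 0 < r ∧ ¬ (0 < l ∧ ¬ key (r - 1) < key (l - 1)) then r else l

/-- The winner of a block is one of its entries, and it is nonempty with minimal key as soon as the
block has a nonempty entry. -/
theorem treeVal_minEntry (key : ℕ → ℝ) (L : ℕ → ℕ) (h p : ℕ) :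
    (∃ q < 2 ^ h, L (p + q) = treeVal (minEntry key) L h p) ∧
      ∀ q < 2 ^ h, L (p + q) ≠ 0 → treeVal (minEntry key) L h p ≠ 0 ∧
        key (treeVal (minEntry key) L h p - 1) ≤ key (L (p + q) - 1) := by
  induction h generalizing p with
  | zero => simp [treeVal]
  | succ h ih =>
    obtain ⟨⟨q₁, hq₁, e₁⟩, h₁⟩ := ih p
    obtain ⟨⟨q₂, hq₂, e₂⟩, h₂⟩ := ih (p + 2 ^ h)
    rw [treeVal]
    set l := treeVal (minEntry key) L h p
    set r := treeVal (minEntry key) L h (p + 2 ^ h)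
    have split : ∀ q < 2 ^ (h + 1), q < 2 ^ h ∨ ∃ q' < 2 ^ h, q = 2 ^ h + q' := by
      intro q hq
      rw [pow_succ] at hq
      by_cases hc : q < 2 ^ h
      · exact Or.inl hc
      · exact Or.inr ⟨q - 2 ^ h, by lia, by lia⟩
    unfold minEntry
    split_ifs with hc
    · refine ⟨⟨2 ^ h + q₂, by rw [pow_succ]; lia, by rw [← add_assoc, e₂]⟩, fun q hq hL => ?_⟩
      obtain hq | ⟨q, hq', rfl⟩ := split q hq
      · obtain ⟨hl, hle⟩ := h₁ q hq hL
        have : key (r - 1) < key (l - 1) := by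
          by_contra hlt; exact hc.2 ⟨Nat.pos_of_ne_zero hl, hlt⟩
        exact ⟨hc.1.ne', this.le.trans hle⟩
      · rw [← add_assoc] at hL ⊢
        exact h₂ q hq' hL
    · refine ⟨⟨q₁, by rw [pow_succ]; lia, e₁⟩, fun q hq hL => ?_⟩
      obtain hq | ⟨q, hq', rfl⟩ := split q hq
      · exact h₁ q hq hL
      · rw [← add_assoc] at hL ⊢
        obtain ⟨hr, hle⟩ := h₂ q hq' hL
        have : 0 < l ∧ ¬ key (r - 1) < key (l - 1) := by
          by_contra hlt; exact hc ⟨Nat.pos_of_ne_zero hr, hlt⟩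
        exact ⟨this.1.ne', (not_lt.mp this.2).trans hle⟩

/-- The list `out 0, …, out (n - 1)` enumerates `0, …, n - 1` in the order of the keys. -/
structure SortedBy (key : ℕ → ℝ) (n : ℕ) (out : ℕ → ℕ) : Prop where
  lt : ∀ k < n, out k < n
  inj : ∀ k < n, ∀ l < n, out k = out l → k = l
  le : ∀ k l, k ≤ l → l < n → key (out k) ≤ key (out l)

theorem SortedBy.surj {key : ℕ → ℝ} {n : ℕ} {out : ℕ → ℕ} (h : SortedBy key n out) {i : ℕ}
    (hi : i < n) : ∃ k < n, out k = i := by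
  have := Finset.surjOn_of_injOn_of_card_le (s := Finset.range n) (t := Finset.range n) out
    (fun k hk => by simpa using h.lt k (by simpa using hk))
    (fun k hk l hl e => h.inj k (by simpa using hk) l (by simpa using hl) e) le_rfl
  obtain ⟨k, hk, e⟩ := this (by simpa using hi : i ∈ (Finset.range n : Set ℕ))
  exact ⟨k, by simpa using hk, e⟩

/-! ### Sorting with a tournament tree. -/

namespace RealRAM

/-- Go to the parent of the current node of the tournament tree `nat Tr` for the keys `real Ky`, and
recompute it. -/
def minStep (Ky Tr : ℕ) : Program :=
  .seq (.setNat 4 (.const 0) (.half (.get 4 (.const 0))))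
    (.ite
      (.and (.natLt (.const 0) (.get Tr (.add (.add (.get 4 (.const 0)) (.get 4 (.const 0))) (.const 1))))
        (.not (.and (.natLt (.const 0) (.get Tr (.add (.get 4 (.const 0)) (.get 4 (.const 0)))))
          (.not (.realLt
            (.get Ky (.sub (.get Tr (.add (.add (.get 4 (.const 0)) (.get 4 (.const 0))) (.const 1)))
              (.const 1)))
            (.get Ky (.sub (.get Tr (.add (.get 4 (.const 0)) (.get 4 (.const 0)))) (.const 1))))))))
      (.setNat Tr (.get 4 (.const 0))
        (.get Tr (.add (.add (.get 4 (.const 0)) (.get 4 (.const 0))) (.const 1))))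
      (.setNat Tr (.get 4 (.const 0)) (.get Tr (.add (.get 4 (.const 0)) (.get 4 (.const 0))))))

/-- Replace the entry at the leaf `nat 4 0` of the tournament tree `nat Tr` by `e`. -/
def minUpdate (Ky Tr : ℕ) (e : NatExpr) : Program :=
  .seq (.setNat Tr (.get 4 (.const 0)) e) (walkUp (minStep Ky Tr))

/-- Put the indices `0, …, nat 0 0 - 1`, sorted by the keys `real Ky`, into `nat out`. -/
def sort (Ky Tr out : ℕ) : Program :=
  .seq
    (forLoop 1 (.seq (.setNat 4 (.const 0) (.add (.get 3 (.const 0)) (.get 1 (.const 0))))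
      (minUpdate Ky Tr (.add (.get 1 (.const 0)) (.const 1)))))
    (forLoop 1 (.seq (.setNat out (.get 1 (.const 0)) (.sub (.get Tr (.const 1)) (.const 1)))
      (.seq (.setNat 4 (.const 0) (.add (.get 3 (.const 0)) (.get out (.get 1 (.const 0)))))
        (minUpdate Ky Tr (.const 0)))))

theorem Spec.minUpdate {Ky Tr : ℕ} {e : NatExpr} {N K p : ℕ} {key : ℕ → ℝ} {L : ℕ → ℕ} {s : Memory}
    (hT : Tr ≠ 4) (hN : N = 2 ^ K) (hk : s.real Ky = key) (hp : p < N) (hj : s.nat 4 0 = N + p)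
    (ht : IsTree (minEntry key) N L (s.nat Tr)) :
    Spec (RealRAM.minUpdate Ky Tr e) s (e.cost + 3 + (K + 1) * 90)
      fun s' => IsTree (minEntry key) N (Function.update L p (e.eval s)) (s'.nat Tr) := by
  refine (Spec.seq (Spec.exec rfl ?_)).mono (T := 2 + e.cost + 1 + (K + 1) * 90) (by lia)
    fun _ h => h
  refine (Spec.walkUp hN (fun s => s.nat Tr) (fun s => s.real Ky = key) rfl ?_ ?_ ?_ ?_ ?_).mono
    ?_ fun _ h => h
  · intro s hs
    rwa [Program.exec_real_eq rfl (by simp [minStep])]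
  · intro s
    rw [minStep, Program.exec, Program.exec_nat_eq rfl (by simp [hT.symm])]
    simp
  · intro s hs
    simp only [minStep, Program.exec, minEntry]
    simp only [NatExpr.eval, Cond.Holds, RealExpr.eval, Memory.setNat_real, hs,
      Memory.setNat_nat_self, Function.update_self, Memory.setNat_nat_of_ne _ _ _ hT]
    split_ifs <;> simp [hT]
  · simpa using hk
  · simp only [Program.exec, NatExpr.eval, Memory.setNat_nat_self, hj, ne_eq, hT.symm,
      not_false_eq_true, Memory.setNat_nat_of_ne]
    exact ht.update hp _
  · exact Nat.mul_le_mul_left _ (by simp [minStep, Program.bound, Cond.cost, NatExpr.cost, RealExpr.cost])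

/-- All items are inserted at their own leaves; then the winner at the root is output and its leaf
is emptied, `n` times. Each of the `2 * n` updates costs one walk to the root. -/
theorem Spec.sort {Ky Tr out N K n : ℕ} {key : ℕ → ℝ} {s : Memory}
    (hT : Tr ∉ [0, 1, 3, 4]) (ho : out ∉ [0, 1, 3, 4, Tr]) (hN : N = 2 ^ K) (hnN : n ≤ N)
    (hn : s.nat 0 0 = n) (hsN : s.nat 3 0 = N) (hk : s.real Ky = key)
    (ht : IsTree (minEntry key) N (fun _ => 0) (s.nat Tr)) :
    Spec (RealRAM.sort Ky Tr out) s ((n + 1) * (K + 1) * 300)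
      fun s' => SortedBy key n (s'.nat out) := by
  simp only [List.mem_cons, List.not_mem_nil, or_false, not_or] at hT ho
  obtain ⟨hT0, hT1, hT3, hT4⟩ := hT
  obtain ⟨ho0, ho1, ho3, ho4, hoT⟩ := ho
  refine (Spec.seq (T := n * ((K + 1) * 90 + 32) + 9) (T' := n * ((K + 1) * 90 + 32) + 9) ?_).mono
    (by ring_nf; lia) fun _ h => h
  refine (Spec.forLoop (T := (K + 1) * 90 + 20)
    (fun k s => s.nat 3 0 = N ∧ s.real Ky = key ∧
      IsTree (minEntry key) N (fun i => if i < k then i + 1 else 0) (s.nat Tr))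
    one_ne_zero ?_ ?_ ?_ hn ?_).frame.mono (by ring_nf; lia) ?_
  · simp [RealRAM.minUpdate, RealRAM.walkUp, minStep, Ne.symm hT1]
  · simp [RealRAM.minUpdate, RealRAM.walkUp, minStep, Ne.symm hT0]
  · rintro k s hkn h1 h0 ⟨h3, hky, htr⟩
    refine (Spec.seq (Spec.exec rfl ((Spec.minUpdate hT4 hN (key := key) (p := k)
      (L := fun i => if i < k then i + 1 else 0) ?_ (by lia) ?_ ?_).frame.mono le_rfl ?_))).mono
      ?_ fun _ h => h
    · simpa using hky
    · simp [h1, h3]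
    · simpa [hT4] using htr
    · rintro s' ⟨hs', hfn, hfr⟩
      refine ⟨?_, ?_, ?_⟩
      · rw [Memory.setNat_nat_of_ne _ _ _ (by simp), hfn 3 (by
          simp [RealRAM.minUpdate, RealRAM.walkUp, minStep, Ne.symm hT3])]
        simpa using h3
      · rw [Memory.setNat_real, hfr Ky (by simp [RealRAM.minUpdate, RealRAM.walkUp, minStep])]
        simpa using hky
      · rw [Memory.setNat_nat_of_ne _ _ _ hT1]
        convert hs' using 2 with i
        simp only [Function.update_apply, Program.exec, NatExpr.eval]
        simp only [ne_eq, OfNat.one_ne_ofNat, not_false_eq_true, Memory.setNat_nat_of_ne, h1]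
        split_ifs <;> lia
    · simp [Program.bound, NatExpr.cost]; lia
  · simpa [hT1, hsN, hk] using ht
  rintro s₁ ⟨⟨h3, hky, htr⟩, hfn, hfr⟩
  have h0 : s₁.nat 0 0 = n := by
    rw [hfn 0 (by simp [RealRAM.minUpdate, RealRAM.walkUp, minStep, Ne.symm hT0]), hn]
  -- After `k` extractions the output is sorted and free of repetitions, no remaining item has a
  -- smaller key than an extracted one, and the tree holds exactly the remaining items.
  refine (Spec.forLoop (T := (K + 1) * 90 + 20)
    (fun k s => s.nat 3 0 = N ∧ s.real Ky = key ∧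
      (∀ l < k, s.nat out l < n) ∧ (∀ l < k, ∀ m < l, s.nat out m ≠ s.nat out l) ∧
      (∀ i < n, (∀ l < k, s.nat out l ≠ i) → ∀ l < k, key (s.nat out l) ≤ key i) ∧
      (∀ m l, m ≤ l → l < k → key (s.nat out m) ≤ key (s.nat out l)) ∧
      IsTree (minEntry key) N (fun i => open Classical in
        if i < n ∧ ∀ l < k, s.nat out l ≠ i then i + 1 else 0) (s.nat Tr))
    one_ne_zero ?_ ?_ ?_ h0 ?_).mono (by ring_nf; lia) ?_
  · simp [RealRAM.minUpdate, RealRAM.walkUp, minStep, Ne.symm hT1, Ne.symm ho1]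
  · simp [RealRAM.minUpdate, RealRAM.walkUp, minStep, Ne.symm hT0, Ne.symm ho0]
  · rintro k s hkn h1 h0 ⟨h3, hky, hlt, hinj, hmin, hle, htr⟩
    have hroot := hN ▸ htr
    have hroot := hroot.root_eq
    obtain ⟨⟨q, hq, hLq⟩, hall⟩ := treeVal_minEntry key (fun i => open Classical in
        if i < n ∧ ∀ l < k, s.nat out l ≠ i then i + 1 else 0) K 0
    rw [← hroot, zero_add] at hLq
    simp only [← hroot, zero_add] at hall
    -- Only `k < n` items have been extracted, so one is left and the root is nonempty.
    obtain ⟨i, hin, hi⟩ : ∃ i < n, ∀ l < k, s.nat out l ≠ i := by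
      by_contra! hcon
      have : Finset.range n ⊆ (Finset.range k).image (s.nat out) := by
        intro i hi
        obtain ⟨l, hl, e⟩ := hcon i (by simpa using hi)
        exact Finset.mem_image.mpr ⟨l, by simpa using hl, e⟩
      have := (Finset.card_le_card this).trans Finset.card_image_le
      simp at this
      lia
    have hr0 : s.nat Tr 1 ≠ 0 :=
      (hall i (by rw [← hN]; lia) (by simp [hin]; exact hi)).1
    have hcq : q < n ∧ ∀ l < k, s.nat out l ≠ q := by
      by_contra hc
      rw [if_neg hc] at hLq
      exact hr0 hLq.symm
    rw [if_pos hcq] at hLq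
    have hbest : ∀ j < n, (∀ l < k, s.nat out l ≠ j) → key q ≤ key j := by
      intro j hj hjl
      have := (hall j (by rw [← hN]; lia) (by simp [hj]; exact hjl)).2
      rw [if_pos ⟨hj, hjl⟩, ← hLq] at this
      simpa using this
    refine (Spec.seq (Spec.exec rfl (Spec.seq (Spec.exec rfl ((Spec.minUpdate hT4 hN (key := key)
      (p := q) (L := fun i => open Classical in
        if i < n ∧ ∀ l < k, s.nat out l ≠ i then i + 1 else 0) ?_ (hN ▸ hq) ?_ ?_).frame.mono
        le_rfl ?_))))).mono ?_ fun _ h => h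
    · simpa using hky
    · simp [h1, h3, ← hLq, Ne.symm ho3, Ne.symm ho1]
    · simpa [hT4, Ne.symm hoT] using htr
    · rintro s' ⟨hs', hfn, hfr⟩
      have hout : s'.nat out = Function.update (s.nat out) k q := by
        rw [hfn out (by simp [RealRAM.minUpdate, RealRAM.walkUp, minStep, hoT, ho4])]
        simp [ho4, h1, ← hLq]
      have hold : ∀ l < k, Function.update (s.nat out) k q l = s.nat out l := fun l hl =>
        Function.update_of_ne (by lia) _ _
      have hnew : Function.update (s.nat out) k q k = q := Function.update_self _ _ _
      rw [Memory.setNat_real, Memory.setNat_nat_of_ne _ _ _ ho1, Memory.setNat_nat_of_ne _ _ _ hT1,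
        Memory.setNat_nat_of_ne _ _ _ (by simp), hout]
      refine ⟨?_, ?_, ?_, ?_, ?_, ?_, ?_⟩
      · rw [hfn 3 (by simp [RealRAM.minUpdate, RealRAM.walkUp, minStep, Ne.symm hT3])]
        simpa [Ne.symm ho3] using h3
      · rw [hfr Ky (by simp [RealRAM.minUpdate, RealRAM.walkUp, minStep])]
        simpa using hky
      · intro l hl
        obtain rfl | hl := Nat.lt_succ_iff_lt_or_eq.mp hl |>.symm
        · rw [hnew]; exact hcq.1
        · rw [hold l hl]; exact hlt l hl
      · intro l hl m hm
        obtain rfl | hl := Nat.lt_succ_iff_lt_or_eq.mp hl |>.symm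
        · rw [hnew, hold m hm]; exact hcq.2 m hm
        · rw [hold l hl, hold m (hm.trans hl)]; exact hinj l hl m hm
      · intro j hj hjl l hl
        have hjk : ∀ l < k, s.nat out l ≠ j := fun l hl => by
          rw [← hold l hl]; exact hjl l (by lia)
        obtain rfl | hl := Nat.lt_succ_iff_lt_or_eq.mp hl |>.symm
        · rw [hnew]; exact hbest j hj hjk
        · rw [hold l hl]; exact hmin j hj hjk l hl
      · intro m l hml hl
        obtain rfl | hl := Nat.lt_succ_iff_lt_or_eq.mp hl |>.symm
        · obtain rfl | hm := eq_or_lt_of_le hml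
          · exact le_rfl
          · rw [hnew, hold m hm]; exact hmin q hcq.1 hcq.2 m hm
        · rw [hold l hl, hold m (by lia)]; exact hle m l hml hl
      · convert hs' using 2 with i
        simp only [Function.update_apply, NatExpr.eval]
        by_cases hiq : i = q
        · rw [if_pos hiq, if_neg]
          rintro ⟨-, hc⟩
          exact hc k (by lia) (by simp [hiq])
        · rw [if_neg hiq]
          congr 1
          refine propext (and_congr_right fun _ => ⟨fun h l hl => ?_, fun h l hl => ?_⟩)
          · have := h l (by lia)
            rwa [if_neg (by lia)] at this
          · split_ifs with hc
            · exact Ne.symm hiq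
            · exact h l (by lia)
    · simp [Program.bound, NatExpr.cost]; lia
  · simp only [Memory.setNat_nat_of_ne _ _ _ hT1]
    refine ⟨by simpa using h3, by simpa using hky, by simp, by simp, by simp, by simp, ?_⟩
    simpa using htr
  · rintro s' ⟨-, -, hlt, hinj, -, hle, -⟩
    refine ⟨hlt, fun k hk l hl e => ?_, hle⟩
    rcases lt_trichotomy k l with h | h | h
    · exact absurd e (hinj l hl k h)
    · exact h
    · exact absurd e.symm (hinj k hk l h)

end RealRAM

/-! ### Trees for sums and extreme prefix sums -/

/-- Combination of two consecutive blocks, each given by its sum, its greatest prefix sum and its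
least prefix sum. -/
noncomputable def prefOp (l r : ℝ × ℝ × ℝ) : ℝ × ℝ × ℝ :=
  (l.1 + r.1, max l.2.1 (l.1 + r.2.1), min l.2.2 (l.1 + r.2.2))

/-- The block with the single entry `x`. -/
noncomputable def prefLeaf (x : ℝ) : ℝ × ℝ × ℝ := (x, max 0 x, min 0 x)

/-- The sums of at most `m` of the numbers `δ p, δ (p + 1), …` from the first one on. -/
def prefixSums (δ : ℕ → ℝ) (p m : ℕ) : Set ℝ := {x | ∃ j ≤ m, x = ∑ q ∈ Finset.range j, δ (p + q)}

/-- A prefix of two joined blocks either ends in the first block or consists of the whole first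
block and a prefix of the second. This is the reason for the form of `prefOp`. -/
theorem prefixSums_add (δ : ℕ → ℝ) (p m m' : ℕ) : prefixSums δ p (m + m') =
    prefixSums δ p m ∪ (fun x => ∑ q ∈ Finset.range m, δ (p + q) + x) '' prefixSums δ (p + m) m' := by
  ext x
  constructor
  · rintro ⟨j, hj, rfl⟩
    by_cases hjm : j ≤ m
    · exact Or.inl ⟨j, hjm, rfl⟩
    · obtain ⟨i, rfl⟩ := Nat.exists_eq_add_of_le (not_le.mp hjm).le
      exact Or.inr ⟨_, ⟨i, by lia, rfl⟩, by simp only [Finset.sum_range_add, add_assoc]⟩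
  · rintro (⟨j, hj, rfl⟩ | ⟨_, ⟨j, hj, rfl⟩, rfl⟩)
    · exact ⟨j, by lia, rfl⟩
    · exact ⟨m + j, by lia, by simp only [Finset.sum_range_add, add_assoc]⟩

theorem treeVal_prefOp (δ : ℕ → ℝ) (h p : ℕ) :
    (treeVal prefOp (fun q => prefLeaf (δ q)) h p).1 = ∑ q ∈ Finset.range (2 ^ h), δ (p + q) ∧
    IsGreatest (prefixSums δ p (2 ^ h)) (treeVal prefOp (fun q => prefLeaf (δ q)) h p).2.1 ∧
    IsLeast (prefixSums δ p (2 ^ h)) (treeVal prefOp (fun q => prefLeaf (δ q)) h p).2.2 := by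
  induction h generalizing p with
  | zero =>
    have : prefixSums δ p (2 ^ 0) = {0, δ p} := by
      ext x
      constructor
      · rintro ⟨j, hj, rfl⟩
        obtain rfl | rfl : j = 0 ∨ j = 1 := by simp at hj; lia
        all_goals simp
      · rintro (rfl | rfl)
        exacts [⟨0, by simp, by simp⟩, ⟨1, by simp, by simp⟩]
    rw [this]
    exact ⟨by simp [treeVal, prefLeaf], isGreatest_pair, isLeast_pair⟩
  | succ h ih =>
    obtain ⟨s₁, g₁, l₁⟩ := ih p
    obtain ⟨s₂, g₂, l₂⟩ := ih (p + 2 ^ h)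
    have hm : Monotone fun x => ∑ q ∈ Finset.range (2 ^ h), δ (p + q) + x :=
      fun _ _ hxy => add_le_add_right hxy _
    rw [pow_succ, mul_two, prefixSums_add, treeVal]
    simp only [prefOp, s₁, s₂, Finset.sum_range_add, ← add_assoc]
    exact ⟨trivial, g₁.union (hm.map_isGreatest g₂), l₁.union (hm.map_isLeast l₂)⟩

/-! ### Weighted items, ordered by ranks -/

section Items

variable (n : ℕ) (ρ : ℕ → ℕ) (β β' W : ℕ → ℝ)

/-- The weighted sum of the values `β' i` of the items with rank less than `p` and the values `β i` of
the other items. -/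
noncomputable def splitSum (p : ℕ) : ℝ :=
  ∑ i ∈ Finset.range n, W i * if ρ i < p then β' i else β i

/-- The difference between consecutive sums `splitSum`. -/
noncomputable def splitDiff (q : ℕ) : ℝ :=
  ∑ i ∈ Finset.range n, if ρ i = q then W i * (β' i - β i) else 0

/-- Moving the cut past rank `q` switches the items of that rank from `β` to `β'`. Thus all split
sums are prefix sums of the jumps, shifted by one base value. -/
theorem splitSum_eq (p : ℕ) : splitSum n ρ β β' W p =
    ∑ i ∈ Finset.range n, W i * β i + ∑ q ∈ Finset.range p, splitDiff n ρ β β' W q := by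
  unfold splitSum splitDiff
  rw [Finset.sum_comm, ← Finset.sum_add_distrib]
  refine Finset.sum_congr rfl fun i _ => ?_
  rw [Finset.sum_ite_eq]
  simp only [Finset.mem_range]
  split_ifs <;> ring

-- The tree is indexed by ranks, so changing the weight of one item touches a single leaf, whichever
-- other items share its rank.
variable {n W} in
theorem splitDiff_update {i : ℕ} (hi : i < n) (w : ℝ) :
    splitDiff n ρ β β' (Function.update W i (W i + w)) = Function.update (splitDiff n ρ β β' W) (ρ i)
      (splitDiff n ρ β β' W (ρ i) + w * (β' i - β i)) := by
  have e : ∀ j, Function.update W i (W i + w) j = W j + if i = j then w else 0 := by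
    intro j
    by_cases h : i = j
    · subst h; simp
    · simp [h, Function.update_of_ne (Ne.symm h)]
  have key : ∀ q, splitDiff n ρ β β' (Function.update W i (W i + w)) q =
      splitDiff n ρ β β' W q + if ρ i = q then w * (β' i - β i) else 0 := by
    intro q
    have : (if ρ i = q then w * (β' i - β i) else 0) =
        ∑ j ∈ Finset.range n, if i = j then (if ρ j = q then w * (β' j - β j) else 0) else 0 := by
      rw [Finset.sum_ite_eq, if_pos (Finset.mem_range.mpr hi)]
    rw [this, splitDiff, splitDiff, ← Finset.sum_add_distrib]
    refine Finset.sum_congr rfl fun j _ => ?_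
    rw [e]
    split_ifs <;> ring
  funext q
  by_cases h : q = ρ i
  · subst h; rw [key, if_pos rfl, Function.update_self]
  · rw [key, if_neg (Ne.symm h), Function.update_of_ne h, add_zero]

variable {n W} in
theorem sum_update_mul {i : ℕ} (hi : i < n) (w : ℝ) :
    ∑ j ∈ Finset.range n, Function.update W i (W i + w) j * β j =
      ∑ j ∈ Finset.range n, W j * β j + w * β i := by
  have : w * β i = ∑ j ∈ Finset.range n, if i = j then w * β j else 0 := by
    rw [Finset.sum_ite_eq, if_pos (Finset.mem_range.mpr hi)]
  rw [this, ← Finset.sum_add_distrib]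
  refine Finset.sum_congr rfl fun j _ => ?_
  by_cases h : i = j
  · subst h; rw [Function.update_self, if_pos rfl]; ring
  · rw [Function.update_of_ne (Ne.symm h), if_neg h, add_zero]

end Items

/-! ### The tree of prefix sums on the machine. -/

namespace RealRAM

/-- Assign the greater one of two values. -/
def setMax (A : ℕ) (i : NatExpr) (e e' : RealExpr) : Program :=
  .ite (.realLt e e') (.setReal A i e') (.setReal A i e)

/-- Assign the smaller one of two values. -/
def setMin (A : ℕ) (i : NatExpr) (e e' : RealExpr) : Program :=
  .ite (.realLt e e') (.setReal A i e) (.setReal A i e')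

@[simp] theorem exec_setMax (A : ℕ) (i : NatExpr) (e e' : RealExpr) (s : Memory) :
    (setMax A i e e').exec s = s.setReal A (i.eval s) (max (e.eval s) (e'.eval s)) := by
  by_cases h : e.eval s < e'.eval s
  · simp [setMax, h, h.le]
  · simp [setMax, h, not_lt.mp h]

@[simp] theorem exec_setMin (A : ℕ) (i : NatExpr) (e e' : RealExpr) (s : Memory) :
    (setMin A i e e').exec s = s.setReal A (i.eval s) (min (e.eval s) (e'.eval s)) := by
  by_cases h : e.eval s < e'.eval s
  · simp [setMin, h, h.le]
  · simp [setMin, h, not_lt.mp h]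

/-- Node of the tree for prefix sums. -/
def prefNode (s : Memory) (j : ℕ) : ℝ × ℝ × ℝ := (s.real 14 j, s.real 12 j, s.real 13 j)

/-- The current node, and the children of the current node. -/
def cur : NatExpr := .get 4 (.const 0)

/-- The left child of the node of the cursor. -/
def left : NatExpr := .add cur cur

/-- The right child of the node of the cursor. -/
def right : NatExpr := .add left (.const 1)

/-- Go to the parent of the current node of the tree for prefix sums, and recompute it. -/
def prefStep : Program :=
  .seq (.setNat 4 (.const 0) (.half cur))
    (.seq (setMax 12 cur (.get 12 left) (.add (.get 14 left) (.get 12 right)))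
      (.seq (setMin 13 cur (.get 13 left) (.add (.get 14 left) (.get 13 right)))
        (.setReal 14 cur (.add (.get 14 left) (.get 14 right)))))

/-- Add the number `real 18 0` to the weight of the item `nat 5 0`. -/
def addWeight : Program :=
  .seq (.setReal 15 (.const 0) (.add (.get 15 (.const 0))
      (.mul (.get 18 (.const 0)) (.get 8 (.get 5 (.const 0))))))
    (.seq (.setNat 4 (.const 0) (.add (.get 3 (.const 0)) (.get 11 (.get 5 (.const 0)))))
      (.seq (.setReal 14 cur (.add (.get 14 cur) (.mul (.get 18 (.const 0))
          (.sub (.get 9 (.get 5 (.const 0))) (.get 8 (.get 5 (.const 0)))))))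
        (.seq (setMax 12 cur (.const 0) (.get 14 cur))
          (.seq (setMin 13 cur (.const 0) (.get 14 cur)) (walkUp prefStep)))))

/-- Replace `real 16 0` by the greatest absolute value of a split sum, if that is greater. -/
def query : Program :=
  .seq (setMax 16 (.const 0) (.get 16 (.const 0)) (.add (.get 15 (.const 0)) (.get 12 (.const 1))))
    (setMax 16 (.const 0) (.get 16 (.const 0))
      (.sub (.const 0) (.add (.get 15 (.const 0)) (.get 13 (.const 1)))))

/-- The tree for prefix sums and the variable `real 15 0` describe the items with weights `W`. -/
def Loaded (n N : ℕ) (ρ : ℕ → ℕ) (β β' W : ℕ → ℝ) (s : Memory) : Prop :=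
  IsTree prefOp N (fun q => prefLeaf (splitDiff n ρ β β' W q)) (prefNode s) ∧
    s.real 15 0 = ∑ i ∈ Finset.range n, W i * β i

theorem Loaded.congr {n N : ℕ} {ρ : ℕ → ℕ} {β β' W W' : ℕ → ℝ} {s : Memory}
    (h : Loaded n N ρ β β' W s) (hW : ∀ i < n, W i = W' i) : Loaded n N ρ β β' W' s := by
  have e : splitDiff n ρ β β' W = splitDiff n ρ β β' W' := by
    funext q
    exact Finset.sum_congr rfl fun i hi => by rw [hW i (Finset.mem_range.mp hi)]
  refine ⟨e ▸ h.1, h.2.trans ?_⟩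
  exact Finset.sum_congr rfl fun i hi => by rw [hW i (Finset.mem_range.mp hi)]

theorem Loaded.of_real_eq {n N : ℕ} {ρ : ℕ → ℕ} {β β' W : ℕ → ℝ} {s s' : Memory}
    (h : Loaded n N ρ β β' W s) (h12 : s'.real 12 = s.real 12) (h13 : s'.real 13 = s.real 13)
    (h14 : s'.real 14 = s.real 14) (h15 : s'.real 15 = s.real 15) : Loaded n N ρ β β' W s' := by
  have e : prefNode s' = prefNode s := by funext j; simp [prefNode, h12, h13, h14]
  exact ⟨e ▸ h.1, by rw [h15, h.2]⟩

/-- By `splitSum_eq`, the extreme prefix sums at the root, shifted by the base value `real 15 0`,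
are the extreme split sums. -/
theorem Loaded.greatest {n N K : ℕ} {ρ : ℕ → ℕ} {β β' W : ℕ → ℝ} {s : Memory} (hN : N = 2 ^ K)
    (h : Loaded n N ρ β β' W s) :
    IsGreatest (splitSum n ρ β β' W '' Set.Iic N) (s.real 15 0 + s.real 12 1) ∧
    IsLeast (splitSum n ρ β β' W '' Set.Iic N) (s.real 15 0 + s.real 13 1) := by
  subst hN
  obtain ⟨ht, hb⟩ := h
  obtain ⟨-, hg, hl⟩ := treeVal_prefOp (splitDiff n ρ β β' W) K 0
  rw [← ht.root_eq] at hg hl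
  have e : splitSum n ρ β β' W '' Set.Iic (2 ^ K) =
      (fun x => s.real 15 0 + x) '' prefixSums (splitDiff n ρ β β' W) 0 (2 ^ K) := by
    ext x
    constructor
    · rintro ⟨p, hp, rfl⟩
      exact ⟨_, ⟨p, hp, rfl⟩, by simp only [hb, splitSum_eq, zero_add]⟩
    · rintro ⟨_, ⟨p, hp, rfl⟩, rfl⟩
      exact ⟨p, hp, by simp only [hb, splitSum_eq, zero_add]⟩
  have hm : Monotone fun x => s.real 15 0 + x := fun _ _ hxy => add_le_add_right hxy _
  rw [e]
  exact ⟨hm.map_isGreatest hg, hm.map_isLeast hl⟩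

/-- The base value changes by `w * β i`, the leaf of rank `ρ i` by `w * (β' i - β i)`; the ancestors
of that leaf are then recomputed. -/
theorem Spec.addWeight {n N K i : ℕ} {ρ : ℕ → ℕ} {β β' W : ℕ → ℝ} {w : ℝ} {s : Memory}
    (hN : N = 2 ^ K) (hi : i < n) (hρ : ρ i < N) (h3 : s.nat 3 0 = N) (h5 : s.nat 5 0 = i)
    (h11 : s.nat 11 = ρ) (h8 : s.real 8 = β) (h9 : s.real 9 = β') (h18 : s.real 18 0 = w)
    (h : Loaded n N ρ β β' W s) :
    Spec RealRAM.addWeight s ((K + 1) * 200)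
      (Loaded n N ρ β β' (Function.update W i (W i + w))) := by
  obtain ⟨ht, hb⟩ := h
  have hleaf := ht.2 _ hρ
  simp only [prefNode, prefLeaf, Prod.mk.injEq] at hleaf
  refine (Spec.seq (Spec.exec rfl (Spec.seq (Spec.exec rfl (Spec.seq (Spec.exec rfl
    (Spec.seq (Spec.exec rfl (Spec.seq (Spec.exec rfl
      ((Spec.walkUp (K := K) (N := N) (op := prefOp)
        (L := fun q => prefLeaf (splitDiff n ρ β β' (Function.update W i (W i + w)) q)) hN prefNode
        (fun _ => True) rfl (fun _ _ => trivial) ?_ ?_ trivial ?_).frame.mono le_rfl ?_))))))))))).mono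
          ?_ fun _ h => h
  · intro s
    simp [prefStep, cur]
  · intro s _
    funext j
    by_cases hj : j = s.nat 4 0 / 2
    · subst hj
      simp [prefStep, prefNode, prefOp, cur, left, right]
    · simp [prefStep, prefNode, cur, left, right, hj]
  · have hup := ht.update hρ (prefLeaf (splitDiff n ρ β β' W (ρ i) + w * (β' i - β i)))
    have eL : (fun q => prefLeaf (splitDiff n ρ β β' (Function.update W i (W i + w)) q)) =
        Function.update (fun q => prefLeaf (splitDiff n ρ β β' W q)) (ρ i)
          (prefLeaf (splitDiff n ρ β β' W (ρ i) + w * (β' i - β i))) := by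
      funext q
      rw [splitDiff_update _ _ _ hi]
      by_cases hq : q = ρ i
      · subst hq; simp
      · simp [Function.update_of_ne hq]
    rw [eL]
    convert hup using 1
    · funext j
      by_cases hj : j = N + ρ i
      · subst hj
        simp [prefNode, cur, h3, h5, h11, h8, h9, h18, prefLeaf, hleaf.1]
      · simp [prefNode, cur, h3, h5, h11, h8, h9, h18, Function.update_of_ne hj]
    · simp [cur, h3, h5, h11]
  · rintro s' ⟨hs', -, hfr⟩
    refine ⟨hs', ?_⟩
    rw [hfr 15 (by decide), sum_update_mul _ hi]
    simp [cur, h5, h8, h18, hb]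
  · simp only [Program.bound, NatExpr.cost, RealExpr.cost, cur, left, right, setMax, setMin, prefStep,
      Cond.cost]
    lia

end RealRAM

/-! ### Ranks of the roots, and the initial weights. -/

namespace RealRAM

/-- Increase `nat 6 0` if the current key is greater than the previous one. -/
def nextRank : Program :=
  .ite (.realLt (.get 11 (.get 9 (.sub (.get 1 (.const 0)) (.const 1))))
      (.get 11 (.get 9 (.get 1 (.const 0)))))
    (.setNat 6 (.const 0) (.add (.get 6 (.const 0)) (.const 1))) .skip

/-- Number the different keys in `real 11` in increasing order, and put the numbers of the items into
`nat 11`; the array `nat 9` holds the items in the order of the keys. -/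
def rank : Program :=
  .seq (.setNat 6 (.const 0) (.const 0))
    (forLoop 1 (.seq nextRank
      (.setNat 11 (.get 9 (.get 1 (.const 0))) (.get 6 (.const 0)))))

/-- Equal keys must get equal ranks, since no real cut separates them. The rank of the item at
position `l` is at most `l`, which bounds all ranks by `n`. -/
theorem Spec.rank {n : ℕ} {key : ℕ → ℝ} {O : ℕ → ℕ} {s : Memory} (hn : s.nat 0 0 = n)
    (hk : s.real 11 = key) (hO : s.nat 9 = O) (hsort : SortedBy key n O) :
    Spec RealRAM.rank s ((n + 1) * 60) fun s' => ∀ i < n, s'.nat 11 i < n ∧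
      ∀ j < n, s'.nat 11 i < s'.nat 11 j ↔ key i < key j := by
  refine (Spec.seq (Spec.exec rfl (Spec.forLoop (n := n) (T := 40) (fun k s => s.real 11 = key ∧ s.nat 9 = O ∧
    s.nat 6 0 ≤ k - 1 ∧ (0 < k → s.nat 6 0 = s.nat 11 (O (k - 1))) ∧ ∀ l < k, s.nat 11 (O l) ≤ l ∧
      ∀ m ≤ l, s.nat 11 (O m) ≤ s.nat 11 (O l) ∧
        (s.nat 11 (O m) < s.nat 11 (O l) ↔ key (O m) < key (O l)))
    one_ne_zero (by decide) (by decide) ?_ ?_ ?_))).mono ?_ ?_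
  · rintro k s hkn h1 h0 ⟨hky, hO, h6, hcur, hall⟩
    refine (Spec.exec (Q := fun s' => _) rfl ?_).mono (by decide) fun _ h => h
    -- At `k = 0` the truncated index `k - 1` is `0`, so a key is compared with itself and the first
    -- item gets rank `0`.
    have hstep : key (O (k - 1)) < key (O k) → 0 < k := fun h => by
      rcases Nat.eq_zero_or_pos k with rfl | hk
      · exact absurd h (lt_irrefl _)
      · exact hk
    set c : ℕ := if key (O (k - 1)) < key (O k) then s.nat 6 0 + 1 else s.nat 6 0 with hc
    have hex : ∀ A, (nextRank.exec s).nat A =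
          if A = 6 then Function.update (s.nat 6) 0 c else s.nat A := by
      intro A
      rw [nextRank, Program.exec]
      simp only [Cond.Holds, RealExpr.eval, NatExpr.eval, hky, hO, h1, hc, Program.exec]
      by_cases hlt : key (O (k - 1)) < key (O k)
      · simp only [if_pos hlt]
        split_ifs with hA
        · subst hA; simp
        · simp [hA]
      · simp only [if_neg hlt]
        split_ifs with hA
        · subst hA; simp
        · rfl
    have hlast : ∀ l < k, s.nat 11 (O l) ≤ c ∧ (s.nat 11 (O l) < c ↔ key (O l) < key (O k)) := by
      intro l hl
      obtain ⟨-, h⟩ := hall (k - 1) (by lia)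
      obtain ⟨hle, hiff⟩ := h l (by lia)
      have hkl := hsort.le l (k - 1) (by lia) (by lia)
      have hkk := hsort.le (k - 1) k (by lia) (by lia)
      rw [← hcur (by lia)] at hle hiff
      rw [hc]
      split_ifs with hlt
      · exact ⟨by lia, fun _ => hkl.trans_lt hlt, fun _ => by lia⟩
      · rw [le_antisymm (not_lt.mp hlt) hkk]
        exact ⟨hle, hiff⟩
    have hck : c ≤ k := by
      rw [hc]; split_ifs with hlt
      · have := hstep hlt; lia
      · lia
    have hne : ∀ l < k, O l ≠ O k := fun l hl e => by
      have := hsort.inj l (by lia) k hkn e; lia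
    have hr : (nextRank.exec s).real 11 = key := by
      rwa [Program.exec_real_eq rfl (by decide)]
    rw [Program.exec]
    have h6' := congrFun (hex 6) 0
    have h9' := hex 9
    simp only [↓reduceIte, Function.update_self, Nat.reduceEqDiff, hO] at h6' h9'
    generalize nextRank.exec s = s₁ at hex hr h6' h9'
    simp only [Program.exec, NatExpr.eval, hex, ne_eq, OfNat.ofNat_ne_one, not_false_eq_true,
      Memory.setNat_nat_of_ne, Memory.setNat_nat_self]
    simp only [Nat.reduceEqDiff, ↓reduceIte, OfNat.one_ne_ofNat, h1, hO, add_tsub_cancel_right, h6', h9',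
      Function.update_self, not_false_eq_true, Memory.setNat_real, Memory.setNat_nat_of_ne,
      Nat.lt_add_one_iff, ne_eq]
    refine ⟨hr, trivial, hck, fun _ => trivial, fun l hl => ?_⟩
    obtain rfl | hl := eq_or_lt_of_le hl
    · rw [Function.update_self]
      refine ⟨hck, fun m hm => ?_⟩
      obtain rfl | hm := eq_or_lt_of_le hm
      · simp
      · rw [Function.update_of_ne (hne m hm)]
        exact hlast m hm
    · rw [Function.update_of_ne (hne l hl)]
      refine ⟨(hall l hl).1, fun m hm => ?_⟩
      rw [Function.update_of_ne (hne m (by lia))]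
      exact (hall l hl).2 m hm
  · simpa using hn
  · simp [hk, hO]
  · simp only [Program.bound, NatExpr.cost]; lia
  · rintro s' ⟨-, -, -, -, hall⟩ i hi
    obtain ⟨l, hl, rfl⟩ := hsort.surj hi
    refine ⟨by have := (hall l hl).1; lia, fun j hj => ?_⟩
    obtain ⟨m, hm, rfl⟩ := hsort.surj hj
    rcases le_total l m with h | h
    · exact ((hall m hm).2 l h).2
    · have h1 := ((hall l hl).2 m h).1
      have h2 := hsort.le m l h hl
      exact iff_of_false (by lia) (not_lt.mpr h2)

/-- Set all weights to their initial values, and sum up `1 - (α i * β i) ^ 2 / 2` in `real 17 0`. -/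
def loadAll : Program :=
  forLoop 1 (.seq (.setNat 5 (.const 0) (.get 1 (.const 0)))
    (.seq (.setReal 18 (.const 0) (.get 6 (.get 1 (.const 0))))
      (.seq (.setReal 17 (.const 0) (.add (.get 17 (.const 0))
          (.sub (.const 1) (.div (.mul (.mul (.get 6 (.get 1 (.const 0))) (.get 8 (.get 1 (.const 0))))
            (.mul (.get 6 (.get 1 (.const 0))) (.get 8 (.get 1 (.const 0))))) (.const 2)))))
        addWeight)))

/-- Zeroed memory is already the correct tree for zero weights, so loading is a succession of weight
changes and the tree needs no separate construction. -/
theorem Loaded.zero {n N : ℕ} {ρ : ℕ → ℕ} {β β' : ℕ → ℝ} {s : Memory}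
    (h12 : s.real 12 = fun _ => 0) (h13 : s.real 13 = fun _ => 0) (h14 : s.real 14 = fun _ => 0)
    (h15 : s.real 15 = fun _ => 0) : Loaded n N ρ β β' (fun _ => 0) s := by
  refine ⟨⟨fun k _ _ => ?_, fun p _ => ?_⟩, ?_⟩
  · simp [prefNode, prefOp, h12, h13, h14]
  · simp [prefNode, prefLeaf, h12, h13, h14, splitDiff]
  · simp [h15]

theorem Spec.loadAll {n N K : ℕ} {ρ : ℕ → ℕ} {α β β' : ℕ → ℝ} {s : Memory}
    (hN : N = 2 ^ K) (hρ : ∀ i < n, ρ i < N) (hn : s.nat 0 0 = n) (h3 : s.nat 3 0 = N)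
    (h11 : s.nat 11 = ρ) (h6 : s.real 6 = α) (h8 : s.real 8 = β) (h9 : s.real 9 = β')
    (h17 : s.real 17 0 = 0) (h : Loaded n N ρ β β' (fun _ => 0) s) :
    Spec RealRAM.loadAll s ((n + 1) * (K + 1) * 300) fun s' => Loaded n N ρ β β' α s' ∧
      s'.real 17 0 = ∑ i ∈ Finset.range n, (1 - (α i * β i) * (α i * β i) / 2) := by
  refine (Spec.forLoop (n := n) (T := (K + 1) * 200 + 80)
    (fun k s => s.nat 3 0 = N ∧ s.nat 11 = ρ ∧ s.real 6 = α ∧ s.real 8 = β ∧ s.real 9 = β' ∧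
      Loaded n N ρ β β' (fun i => if i < k then α i else 0) s ∧
      s.real 17 0 = ∑ i ∈ Finset.range k, (1 - (α i * β i) * (α i * β i) / 2))
    one_ne_zero (by decide) (by decide) ?_ hn ?_).mono (by ring_nf; lia) ?_
  · rintro k s hkn h1 h0 ⟨h3, h11, h6, h8, h9, hl, h17⟩
    refine (Spec.seq (Spec.exec rfl (Spec.seq (Spec.exec rfl (Spec.seq (Spec.exec rfl
      ((Spec.addWeight (W := fun i => if i < k then α i else 0) (i := k) (w := α k) hN hkn (hρ k hkn) (by simpa using h3) (by simp [h1])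
        (by simpa using h11) (by simpa using h8) (by simpa using h9) (by simp [h1, h6])
        ?_).frame.mono le_rfl ?_))))))).mono ?_ fun _ h => h
    · exact hl.of_real_eq (by simp) (by simp) (by simp) (by simp)
    · rintro s' ⟨hs', hfn, hfr⟩
      refine ⟨?_, ?_, ?_, ?_, ?_, ?_, ?_⟩
      · simpa [hfn 3 (by decide)] using h3
      · simpa [hfn 11 (by decide)] using h11
      · simpa [hfr 6 (by decide)] using h6
      · simpa [hfr 8 (by decide)] using h8
      · simpa [hfr 9 (by decide)] using h9
      · have e : (fun i => if i < k + 1 then α i else 0) =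
            Function.update (fun i => if i < k then α i else 0) k ((if k < k then α k else 0) + α k) := by
          funext i
          by_cases hik : i = k
          · subst hik; simp
          · rw [Function.update_of_ne hik]
            exact if_congr (by lia) rfl rfl
        rw [e]
        exact hs'.of_real_eq rfl rfl rfl rfl
      · rw [Finset.sum_range_succ, ← h17, Memory.setNat_real, hfr 17 (by decide)]
        simp [h1, h6, h8]
    · simp only [Program.bound, NatExpr.cost, RealExpr.cost]
      lia
  · exact ⟨by simpa using h3, by simpa using h11, h6, h8, h9, by
      simp only [Nat.not_lt_zero, if_false]
      exact h.of_real_eq rfl rfl rfl rfl,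
      by simpa using h17⟩
  · rintro s' ⟨-, -, -, -, -, hl, h17⟩
    exact ⟨hl.congr fun i hi => if_pos hi, h17⟩

end RealRAM

/-! ### The sweep over the roots of the first family of forms. -/

/-- Weights of the items to the left and to the right of `σ`. -/
noncomputable def cutWeight (key α α' : ℕ → ℝ) (σ : ℝ) (i : ℕ) : ℝ :=
  if key i < σ then α' i else α i

/-- `b` is the absolute value of a split sum, and it is greatest among the split sums for cuts in
`S`. -/
def IsBest (n N : ℕ) (ρ : ℕ → ℕ) (β β' key α α' : ℕ → ℝ) (S : Set ℝ) (b : ℝ) : Prop :=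
  (∃ σ, ∃ p ≤ N, b = splitSum n ρ β β' (cutWeight key α α' σ) p ∨
    b = -splitSum n ρ β β' (cutWeight key α α' σ) p) ∧
  ∀ σ ∈ S, ∀ p ≤ N, |splitSum n ρ β β' (cutWeight key α α' σ) p| ≤ b

namespace RealRAM

/-- Move a point from left to right past all the keys in `real 10`, and record the greatest absolute
value of a split sum. The array `nat 8` holds the items in the order of the keys. -/
def sweep : Program :=
  .seq (.setReal 16 (.const 0) (.add (.get 15 (.const 0)) (.get 12 (.const 1))))
    (.seq query (.seq (forLoop 1 (.seq (.setNat 5 (.const 0) (.get 8 (.get 1 (.const 0))))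
      (.seq (.ite (.realLt (.get 10 (.get 8 (.sub (.get 1 (.const 0)) (.const 1))))
          (.get 10 (.get 5 (.const 0)))) query .skip)
        (.seq (.setReal 18 (.const 0) (.sub (.get 7 (.get 5 (.const 0))) (.get 6 (.get 5 (.const 0)))))
          addWeight)))) query))

/-- One query deals with every cut `τ` that induces the current weights. The greatest modulus is
attained at the greatest or at the least split sum. -/
theorem exec_query {n N K : ℕ} {ρ : ℕ → ℕ} {β β' key α α' W : ℕ → ℝ} {S : Set ℝ} {s : Memory}
    (hN : N = 2 ^ K) (h : Loaded n N ρ β β' W s) {σ : ℝ}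
    (hW : ∀ i < n, W i = cutWeight key α α' σ i)
    (hb : IsBest n N ρ β β' key α α' S (s.real 16 0)) :
    IsBest n N ρ β β' key α α'
      (S ∪ {τ | ∀ i < n, cutWeight key α α' τ i = cutWeight key α α' σ i})
      ((query.exec s).real 16 0) := by
  have e : ∀ W', (∀ i < n, W i = W' i) → splitSum n ρ β β' W' = splitSum n ρ β β' W := by
    intro W' hW'
    funext p
    exact Finset.sum_congr rfl fun i hi => by rw [hW' i (Finset.mem_range.mp hi)]
  obtain ⟨⟨⟨p₁, hp₁, e₁⟩, hg⟩, ⟨⟨p₂, hp₂, e₂⟩, hl⟩⟩ := h.greatest hN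
  simp only [query, Program.exec, exec_setMax, RealExpr.eval, NatExpr.eval, Memory.setReal_real_self,
    Function.update_self, ne_eq, Nat.reduceEqDiff, not_false_eq_true,
    Memory.setReal_real_of_ne, Rat.cast_zero, zero_sub]
  rw [← e₁, ← e₂]
  have eσ := e _ hW
  refine ⟨?_, ?_⟩
  · rcases max_choice (max (s.real 16 0) (splitSum n ρ β β' W p₁)) (-splitSum n ρ β β' W p₂)
      with h | h
    · rw [h]
      rcases max_choice (s.real 16 0) (splitSum n ρ β β' W p₁) with h | h
      · rw [h]; exact hb.1
      · rw [h]; exact ⟨σ, p₁, hp₁, Or.inl (by rw [eσ])⟩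
    · rw [h]; exact ⟨σ, p₂, hp₂, Or.inr (by rw [eσ])⟩
  · rintro τ (hτ | hτ) p hp
    · exact (hb.2 τ hτ p hp).trans ((le_max_left _ _).trans (le_max_left _ _))
    · rw [e _ fun i hi => (hW i hi).trans (hτ i hi).symm, abs_le']
      exact ⟨(hg ⟨p, hp, rfl⟩).trans (e₁ ▸ (le_max_right _ _).trans (le_max_left _ _)),
        (neg_le_neg (hl ⟨p, hp, rfl⟩)).trans (e₂ ▸ le_max_right _ _)⟩

/-- Between consecutive different keys the weights do not depend on the cut, so one query per gap,
together with one before the first key and one after the last, covers all real cuts. -/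
theorem Spec.sweep {n N K : ℕ} {ρ O : ℕ → ℕ} {β β' key α α' : ℕ → ℝ} {s : Memory}
    (hN : N = 2 ^ K) (hρ : ∀ i < n, ρ i < N) (hn : s.nat 0 0 = n) (h3 : s.nat 3 0 = N)
    (h8n : s.nat 8 = O) (hsort : SortedBy key n O)
    (h11 : s.nat 11 = ρ) (h6 : s.real 6 = α) (h7 : s.real 7 = α') (h8 : s.real 8 = β)
    (h9 : s.real 9 = β') (h10 : s.real 10 = key) (h : Loaded n N ρ β β' α s) :
    Spec RealRAM.sweep s ((n + 1) * (K + 1) * 500) fun s' =>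
      IsBest n N ρ β β' key α α' Set.univ (s'.real 16 0) := by
  classical
  -- the least key, or any number if there are no keys
  obtain ⟨σ₀, hσ₀⟩ : ∃ σ₀ : ℝ, ∀ i < n, σ₀ ≤ key i := by
    rcases Nat.eq_zero_or_pos n with rfl | hpos
    · exact ⟨0, by simp⟩
    · refine ⟨key (O 0), fun i hi => ?_⟩
      obtain ⟨l, hl, rfl⟩ := hsort.surj hi
      exact hsort.le 0 l (by lia) hl
  have hcut₀ : ∀ σ, (∀ i < n, σ ≤ key i) → ∀ i < n, cutWeight key α α' σ i = α i :=
    fun σ hσ i hi => if_neg (not_lt.mpr (hσ i hi))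
  -- The weights once the first `k` items have been passed. They come from a real cut only if that
  -- cut separates the keys at positions `k - 1` and `k`, which fails inside a group of equal keys.
  set Wk : ℕ → ℕ → ℝ := fun k i => if ∃ l < k, O l = i then α' i else α i with hWk
  have hcut : ∀ k σ, (∀ l < k, l < n → key (O l) < σ) → (∀ l, k ≤ l → l < n → σ ≤ key (O l)) →
      k ≤ n → ∀ i < n, Wk k i = cutWeight key α α' σ i := by
    intro k σ h1 h2 hkn i hi
    obtain ⟨l, hl, rfl⟩ := hsort.surj hi
    simp only [hWk, cutWeight]
    by_cases hlk : l < k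
    · rw [if_pos ⟨l, hlk, rfl⟩, if_pos (h1 l hlk hl)]
    · rw [if_neg, if_neg (not_lt.mpr (h2 l (by lia) hl))]
      rintro ⟨m, hm, e⟩
      have := hsort.inj m (by lia) l hl e
      lia
  -- The cuts covered before item `k` is treated: those not to the right of the last passed key, and
  -- those to the left of all keys.
  set D : ℕ → Set ℝ := fun k => {σ | (∃ l < k, σ ≤ key (O l)) ∨ ∀ i < n, σ ≤ key i} with hD
  refine (Spec.seq (Spec.exec rfl (Spec.seq (Spec.exec rfl (Spec.seq (T' := query.bound) (Spec.forLoop (n := n)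
    (T := (K + 1) * 200 + 250)
    (fun k s => s.nat 3 0 = N ∧ s.nat 8 = O ∧ s.nat 11 = ρ ∧ s.real 6 = α ∧ s.real 7 = α' ∧
      s.real 8 = β ∧ s.real 9 = β' ∧ s.real 10 = key ∧ Loaded n N ρ β β' (Wk k) s ∧
      IsBest n N ρ β β' key α α' (D k) (s.real 16 0))
    one_ne_zero (by decide) (by decide) ?_ ?_ ?_ |>.mono le_rfl ?_)))))).mono ?_ fun _ h => h
  · rintro k s hkn h1 h0 ⟨h3, h8n, h11, h6, h7, h8, h9, h10, hl, hb⟩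
    have hmid : Spec (.ite (.realLt (.get 10 (.get 8 (.sub (.get 1 (.const 0)) (.const 1))))
          (.get 10 (.get 5 (.const 0)))) query .skip)
        ((Program.setNat 5 (.const 0) (.get 8 (.get 1 (.const 0)))).exec s) 150 fun s' =>
          Loaded n N ρ β β' (Wk k) s' ∧
            IsBest n N ρ β β' key α α' (D (k + 1)) (s'.real 16 0) := by
      have hl' : Loaded n N ρ β β' (Wk k)
          ((Program.setNat 5 (.const 0) (.get 8 (.get 1 (.const 0)))).exec s) :=
        hl.of_real_eq rfl rfl rfl rfl
      refine (Spec.ite (T := 100) (fun hc => ?_) fun hc => ?_).mono (by decide) fun _ h => h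
      · simp only [Program.exec, NatExpr.eval, Cond.Holds, RealExpr.eval, Memory.setNat_real, h10,
          ne_eq, Nat.reduceEqDiff, not_false_eq_true, Memory.setNat_nat_of_ne,
          h8n, OfNat.one_ne_ofNat, h1, Memory.setNat_nat_self, Function.update_self] at hc
        -- At `k = 0` the test compares a key with itself and fails.
        have hpos : 0 < k := by
          rcases Nat.eq_zero_or_pos k with rfl | hk
          · exact absurd hc (lt_irrefl _)
          · exact hk
        have hW := hcut k (key (O k))
          (fun l hlk hln => (hsort.le l (k - 1) (by lia) (by lia)).trans_lt hc)
          (fun l hkl hln => hsort.le k l hkl hln) hkn.le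
        refine (Spec.exec rfl ⟨hl'.of_real_eq ?_ ?_ ?_ ?_, ?_, ?_⟩).mono (by decide) fun _ h => h
        iterate 4 exact Program.exec_real_eq rfl (by decide) _
        · exact (exec_query hN hl' hW hb).1
        · rintro σ (⟨l, hlk, hσ⟩ | hσ) p hp
          · refine (exec_query hN hl' hW hb).2 σ ?_ p hp
            by_cases hσ' : σ ≤ key (O (k - 1))
            · exact Or.inl (Or.inl ⟨k - 1, by lia, hσ'⟩)
            · right
              have hσk := hσ.trans (hsort.le l k (by lia) hkn)
              intro i hi
              rw [← hW i hi, hcut k σ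
                (fun l hlk hln => (hsort.le l (k - 1) (by lia) (by lia)).trans_lt (not_le.mp hσ'))
                (fun l hkl hln => hσk.trans (hsort.le k l hkl hln)) hkn.le i hi]
          · exact (exec_query hN hl' hW hb).2 σ (Or.inl (Or.inr hσ)) p hp
      · simp only [Program.exec, NatExpr.eval, Cond.Holds, RealExpr.eval, Memory.setNat_real, h10,
          ne_eq, Nat.reduceEqDiff, not_false_eq_true, Memory.setNat_nat_of_ne,
          h8n, OfNat.one_ne_ofNat, h1, Memory.setNat_nat_self, Function.update_self, not_lt] at hc
        refine (Spec.exec rfl ⟨hl', hb.1, ?_⟩).mono (by decide) fun _ h => h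
        rintro σ (⟨l, hlk, hσ⟩ | hσ) p hp
        · refine hb.2 σ ?_ p hp
          rcases Nat.eq_zero_or_pos k with rfl | hk
          · obtain rfl : l = 0 := by lia
            right
            intro i hi
            obtain ⟨m, hm, rfl⟩ := hsort.surj hi
            exact hσ.trans (hsort.le 0 m (by lia) hm)
          · left
            refine ⟨k - 1, by lia, ?_⟩
            exact hσ.trans ((hsort.le l k (by lia) hkn).trans hc)
        · exact hb.2 σ (Or.inr hσ) p hp
    refine (Spec.seq (T' := 150 + ((K + 1) * 200 + 50)) (Spec.exec rfl
      (Spec.seq (T' := (K + 1) * 200 + 50) (hmid.frame.mono le_rfl ?_)))).mono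
      (by simp only [Program.bound, NatExpr.cost]; lia) fun _ h => h
    rintro s₁ ⟨⟨hl₁, hb₁⟩, hfn₁, hfr₁⟩
    have hOk := hsort.lt k hkn
    refine (Spec.seq (Spec.exec rfl ((Spec.addWeight (ρ := ρ) (β := β) (β' := β') (W := Wk k) (i := O k)
      (w := α' (O k) - α (O k)) hN hOk (hρ _ hOk) ?_ ?_ ?_ ?_ ?_ ?_ ?_).frame.mono le_rfl ?_))).mono
      ?_ fun _ h => h
    · simpa [hfn₁ 3 (by decide)] using h3
    · simp [hfn₁ 5 (by decide), h8n, h1]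
    · simpa [hfn₁ 11 (by decide)] using h11
    · simpa [hfr₁ 8 (by decide)] using h8
    · simpa [hfr₁ 9 (by decide)] using h9
    · simp [hfr₁ 6 (by decide), hfr₁ 7 (by decide), hfn₁ 5 (by decide), h8n, h1, h6, h7]
    · exact hl₁.of_real_eq (by simp) (by simp) (by simp) (by simp)
    · rintro s' ⟨hs', hfn, hfr⟩
      refine ⟨?_, ?_, ?_, ?_, ?_, ?_, ?_, ?_, ?_, ?_⟩
      · simpa [hfn 3 (by decide), hfn₁ 3 (by decide)] using h3
      · simpa [hfn 8 (by decide), hfn₁ 8 (by decide)] using h8n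
      · simpa [hfn 11 (by decide), hfn₁ 11 (by decide)] using h11
      · simpa [hfr 6 (by decide), hfr₁ 6 (by decide)] using h6
      · simpa [hfr 7 (by decide), hfr₁ 7 (by decide)] using h7
      · simpa [hfr 8 (by decide), hfr₁ 8 (by decide)] using h8
      · simpa [hfr 9 (by decide), hfr₁ 9 (by decide)] using h9
      · simpa [hfr 10 (by decide), hfr₁ 10 (by decide)] using h10
      · have e : Function.update (Wk k) (O k) (Wk k (O k) + (α' (O k) - α (O k))) = Wk (k + 1) := by
          have hnot : ¬ ∃ l < k, O l = O k := by
            rintro ⟨l, hl, e⟩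
            have := hsort.inj l (by lia) k hkn e
            lia
          funext i
          by_cases hi : i = O k
          · subst hi
            rw [Function.update_self]
            simp only [hWk]
            rw [if_neg hnot, if_pos ⟨k, by lia, rfl⟩]
            ring
          · rw [Function.update_of_ne hi]
            simp only [hWk]
            refine if_congr ⟨?_, ?_⟩ rfl rfl
            · rintro ⟨l, hl, e⟩; exact ⟨l, by lia, e⟩
            · rintro ⟨l, hl, e⟩
              refine ⟨l, ?_, e⟩
              rcases Nat.lt_succ_iff_lt_or_eq.mp hl with h | rfl
              · exact h
              · exact absurd e.symm hi
        exact (e ▸ hs').of_real_eq rfl rfl rfl rfl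
      · simpa [hfr 16 (by decide)] using hb₁
    · simp only [Program.bound, NatExpr.cost, RealExpr.cost]
      lia
  · rw [Program.exec_nat_eq rfl (by decide), Program.exec_nat_eq rfl (by decide), hn]
  · simp only [Memory.setNat_real, ne_eq, OfNat.ofNat_ne_one, not_false_eq_true,
      Memory.setNat_nat_of_ne]
    rw [Program.exec_nat_eq rfl (by decide), Program.exec_nat_eq (A := 8) rfl (by decide),
      Program.exec_nat_eq (A := 11) rfl (by decide), Program.exec_real_eq (A := 6) rfl (by decide),
      Program.exec_real_eq (A := 7) rfl (by decide), Program.exec_real_eq (A := 8) rfl (by decide),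
      Program.exec_real_eq (A := 9) rfl (by decide), Program.exec_real_eq (A := 10) rfl (by decide)]
    have hl' : Loaded n N ρ β β' α
        ((Program.setReal 16 (.const 0)
          (.add (.get 15 (.const 0)) (.get 12 (.const 1)))).exec s) :=
      h.of_real_eq (by simp) (by simp) (by simp) (by simp)
    -- The recorded number has to be an attained value even before any cut is covered, hence the
    -- initialization by the greatest split sum rather than by a constant.
    have hb : IsBest n N ρ β β' key α α' ∅ (((Program.setReal 16 (.const 0)
          (.add (.get 15 (.const 0)) (.get 12 (.const 1)))).exec s).real 16 0) := by
      refine ⟨?_, by simp⟩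
      obtain ⟨⟨p, hp, e⟩, -⟩ := (h.greatest hN).1
      refine ⟨σ₀, p, hp, Or.inl ?_⟩
      simp only [Program.exec, RealExpr.eval, NatExpr.eval, Memory.setReal_real_self,
        Function.update_self]
      rw [← e]
      exact Finset.sum_congr rfl fun i hi => by
        rw [hcut₀ σ₀ hσ₀ i (Finset.mem_range.mp hi)]
    have hq := exec_query hN hl' (fun i hi => (hcut₀ σ₀ hσ₀ i hi).symm) hb
    refine ⟨by simpa using h3, by simpa using h8n, by simpa using h11, by simpa using h6,
      by simpa using h7, by simpa using h8, by simpa using h9, by simpa using h10, ?_, hq.1, ?_⟩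
    · refine (hl'.congr fun i hi => ?_).of_real_eq ?_ ?_ ?_ ?_
      · simp [hWk]
      all_goals exact Program.exec_real_eq rfl (by decide) _
    · rintro σ (⟨l, hl, -⟩ | hσ) p hp
      · lia
      · refine hq.2 σ (Or.inr fun i hi => ?_) p hp
        rw [hcut₀ σ hσ i hi, hcut₀ σ₀ hσ₀ i hi]
  · rintro s₁ ⟨-, -, -, -, -, -, -, -, hl, hb⟩
    -- After the loop all items have been passed; a cut beyond all keys realizes these weights.
    obtain ⟨σ₁, hσ₁⟩ : ∃ σ₁ : ℝ, ∀ i < n, key i < σ₁ := by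
      obtain ⟨M, hM⟩ := ((Finset.range n).image key).bddAbove
      exact ⟨M + 1, fun i hi => (hM (by
        simpa using ⟨i, hi, rfl⟩)).trans_lt (lt_add_one M)⟩
    have hW := hcut n σ₁ (fun l _ hl => hσ₁ _ (hsort.lt l hl)) (fun l h1 h2 => by lia) le_rfl
    refine Spec.exec rfl ⟨(exec_query hN hl hW hb).1, fun σ _ p hp => ?_⟩
    refine (exec_query hN hl hW hb).2 σ ?_ p hp
    by_cases hσ : ∃ l < n, σ ≤ key (O l)
    · exact Or.inl (Or.inl hσ)
    · right
      push Not at hσ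
      intro i hi
      rw [← hW i hi, hcut n σ (fun l hl _ => hσ l hl) (fun l h1 h2 => by lia) le_rfl i hi]
  · simp only [Program.bound, NatExpr.cost, RealExpr.cost, query, setMax, Cond.cost]
    ring_nf
    lia

end RealRAM

/-! ### Pairs of linear forms on the plane -/

/-- The number of `i < n` for which the product of two linear forms is at most zero. -/
noncomputable def crossCount (n : ℕ) (a b c e : ℕ → ℝ) (x y : ℝ × ℝ) : ℕ :=
  ((Finset.range n).filter fun i =>
    (a i * x.1 + b i * x.2) * (c i * y.1 + e i * y.2) ≤ 0).card

theorem crossCount_eq_sum (n : ℕ) (a b c e : ℕ → ℝ) (x y : ℝ × ℝ) :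
    (crossCount n a b c e x y : ℝ) = ∑ i ∈ Finset.range n,
      if (a i * x.1 + b i * x.2) * (c i * y.1 + e i * y.2) ≤ 0 then 1 else 0 := by
  simp [crossCount]

/-- The sign of `x`, or that of `y` if `x = 0`. -/
noncomputable def lexSign (x y : ℝ) : ℝ :=
  if x < 0 then -1 else if 0 < x then 1 else if y < 0 then -1 else if 0 < y then 1 else 0

/-- The square tells only whether the form is identically zero. This makes the quadratic term of the
count independent of the point. -/
theorem lexSign_neg_sq (x y : ℝ) : lexSign (-x) y * lexSign (-x) y = lexSign x y * lexSign x y := by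
  unfold lexSign
  rcases lt_trichotomy x 0 with h | rfl | h
  · simp [h, h.not_gt]
  · simp
  · simp [h, h.not_gt]

/-- The sign of an affine function to the left and to the right of its root. -/
theorem sign_affine {a b s : ℝ} (hs : s ≠ -a / b) :
    (if -a / b < s then lexSign b a else lexSign (-b) a) = SignType.sign (a + b * s) := by
  unfold lexSign
  rcases lt_trichotomy b 0 with h | rfl | h
  · rcases lt_or_gt_of_ne hs with h' | h'
    · have : 0 < a + b * s := by rw [lt_div_iff_of_neg h] at h'; linarith
      simp [h, h.le, h'.not_gt, sign_pos this]
    · have : a + b * s < 0 := by rw [div_lt_iff_of_neg h] at h'; linarith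
      simp [h, h', sign_neg this]
  · rcases lt_trichotomy a 0 with h | rfl | h
    · simp [h, sign_neg h]
    · simp
    · simp [h, h.le, sign_pos h]
  · rcases lt_or_gt_of_ne hs with h' | h'
    · have : a + b * s < 0 := by rw [lt_div_iff₀ h] at h'; linarith
      simp [h, h'.not_gt, sign_neg this]
    · have : 0 < a + b * s := by rw [div_lt_iff₀ h] at h'; linarith
      simp [h, h.le, h', sign_pos this]

/-- On {-1, 0, 1} the indicator of `ε * u ≤ 0` is the polynomial `1 - u ^ 2 / 2 - ε * u / 2`, taken
here at the sign of `f * g`. -/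
theorem indicator_mul_le_zero {ε : ℝ} (hε : ε = 1 ∨ ε = -1) (f g : ℝ) :
    (if f * (ε * g) ≤ 0 then 1 else 0 : ℝ) =
      1 - (SignType.sign f * SignType.sign g : ℝ) * (SignType.sign f * SignType.sign g) / 2 -
        ε / 2 * (SignType.sign f * SignType.sign g) := by
  rw [mul_left_comm]
  have : ∀ u : ℝ, (if ε * u ≤ 0 then 1 else 0 : ℝ) =
      1 - (SignType.sign u : ℝ) * SignType.sign u / 2 - ε / 2 * SignType.sign u := by
    intro u
    rcases hε with rfl | rfl <;> rcases lt_trichotomy u 0 with h | rfl | h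
    · rw [if_pos (by linarith), sign_neg h]; norm_num
    · simp
    · rw [if_neg (by linarith), sign_pos h]; norm_num
    · rw [if_neg (by linarith), sign_neg h]; norm_num
    · simp
    · rw [if_pos (by linarith), sign_pos h]; norm_num
  rw [this, sign_mul]
  simp

section Forms

variable {n : ℕ} {a b c e : ℕ → ℝ}

/-- The sum of the signs of `f g` at the generic point with parameters `s` and `t`. -/
noncomputable def signSum (n : ℕ) (a b c e : ℕ → ℝ) (s t : ℝ) : ℝ :=
  ∑ i ∈ Finset.range n,
    cutWeight (fun i => -a i / b i) (fun i => lexSign (-b i) (a i)) (fun i => lexSign (b i) (a i)) s i *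
      if -c i / e i < t then lexSign (e i) (c i) else lexSign (-e i) (c i)

/-- By `sign_affine` the signs are those to the left or right of the roots, and by `lexSign_neg_sq`
their squares may be evaluated at the left. A form with zero slope has the fictitious root `0`, at
which the sign does not change. -/
theorem crossCount_generic {s t ε : ℝ} (hs : ∀ i < n, s ≠ -a i / b i) (ht : ∀ i < n, t ≠ -c i / e i)
    (hε : ε = 1 ∨ ε = -1) : (crossCount n a b c e (1, s) (ε, ε * t) : ℝ) =
      ∑ i ∈ Finset.range n, (1 - lexSign (-b i) (a i) * lexSign (-e i) (c i) *
        (lexSign (-b i) (a i) * lexSign (-e i) (c i)) / 2) - ε / 2 * signSum n a b c e s t := by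
  rw [crossCount_eq_sum, signSum, Finset.mul_sum, ← Finset.sum_sub_distrib]
  refine Finset.sum_congr rfl fun i hi => ?_
  rw [Finset.mem_range] at hi
  have h1 := sign_affine (hs i hi)
  have h2 := sign_affine (ht i hi)
  have sq : ∀ {p : Prop} [Decidable p] (x y : ℝ), lexSign (-x) y * lexSign (-x) y =
      (if p then lexSign x y else lexSign (-x) y) * (if p then lexSign x y else lexSign (-x) y) := by
    intro p _ x y
    split_ifs
    · exact lexSign_neg_sq x y
    · rfl
  have s1 := h1 ▸ sq (p := -a i / b i < s) (b i) (a i)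
  have s2 := h2 ▸ sq (p := -c i / e i < t) (e i) (c i)
  have := indicator_mul_le_zero hε (a i + b i * s) (c i + e i * t)
  simp only [cutWeight, h1, h2]
  rw [mul_mul_mul_comm (lexSign (-b i) (a i)), s1, s2, ← mul_mul_mul_comm, ← this]
  congr 2
  ring_nf

/-- A slight move to the left preserves all the strict comparisons `κ i < s` and avoids the finitely
many roots. -/
theorem exists_generic (κ : ℕ → ℝ) (n : ℕ) (s : ℝ) :
    ∃ s', ∀ i < n, s' ≠ κ i ∧ (κ i < s' ↔ κ i < s) := by
  have : ∀ i ∈ Set.Iio n, ∀ᶠ s' in nhdsWithin s (Set.Iio s), s' ≠ κ i ∧ (κ i < s' ↔ κ i < s) := by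
    intro i _
    by_cases h : κ i < s
    · filter_upwards [nhdsWithin_le_nhds (Ioi_mem_nhds h)] with s' hs'
      exact ⟨ne_of_gt hs', iff_of_true hs' h⟩
    · filter_upwards [self_mem_nhdsWithin] with s' hs'
      have : s' < κ i := lt_of_lt_of_le hs' (not_lt.mp h)
      exact ⟨this.ne, iff_of_false this.not_gt h⟩
  exact ((Set.finite_Iio n).eventually_all.mpr this).exists

/-- The point `ε (1, s)` is, up to a positive factor, close to `x`, so every form that is nonzero at
`x` keeps its sign, while `s` avoids all roots. -/
theorem exists_perturbation (a b : ℕ → ℝ) (n : ℕ) {x : ℝ × ℝ} (hx : x ≠ 0) :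
    ∃ s ε : ℝ, (ε = 1 ∨ ε = -1) ∧ ∀ i < n, s ≠ -a i / b i ∧
      (a i * x.1 + b i * x.2 ≠ 0 → 0 < (a i * x.1 + b i * x.2) * (ε * (a i + b i * s))) := by
  have pos : ∀ {ε r y : ℝ}, ε * r = y → 0 < r → y ≠ 0 → (ε = 1 ∨ ε = -1) → 0 < y * ε := by
    rintro ε r y rfl hr - (rfl | rfl) <;> linarith
  by_cases h1 : x.1 = 0
  · have h2 : x.2 ≠ 0 := fun h2 => hx (Prod.ext h1 h2)
    obtain ⟨ε, hε, hpos⟩ : ∃ ε : ℝ, (ε = 1 ∨ ε = -1) ∧ 0 < x.2 * ε := by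
      rcases lt_or_gt_of_ne h2 with h | h
      · exact ⟨-1, by simp, by linarith⟩
      · exact ⟨1, by simp, by linarith⟩
    -- For `x = (0, x.2)` the slope is infinite: take `s` large, with `ε` the sign of `x.2`.
    have : ∀ i ∈ Set.Iio n, ∀ᶠ s in atTop, s ≠ -a i / b i ∧
        (a i * x.1 + b i * x.2 ≠ 0 → 0 < (a i * x.1 + b i * x.2) * (ε * (a i + b i * s))) := by
      intro i _
      refine (eventually_ne_atTop _).and ?_
      rw [h1]
      by_cases hb : b i = 0
      · simp [hb]
      · filter_upwards [eventually_gt_atTop (-a i / b i)] with s hs _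
        have hb2 : 0 < b i * b i := mul_self_pos.mpr hb
        have : 0 < b i * (a i + b i * s) := by
          have := mul_pos hb2 (sub_pos.mpr hs)
          have e : b i * b i * (s - -a i / b i) = b i * (a i + b i * s) := by field_simp; ring
          rwa [e] at this
        have := mul_pos hpos this
        linarith
    obtain ⟨s, hs⟩ := ((Set.finite_Iio n).eventually_all.mpr this).exists
    exact ⟨s, ε, hε, hs⟩
  · obtain ⟨ε, hε, hpos⟩ : ∃ ε : ℝ, (ε = 1 ∨ ε = -1) ∧ 0 < x.1 * ε := by
      rcases lt_or_gt_of_ne h1 with h | h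
      · exact ⟨-1, by simp, by linarith⟩
      · exact ⟨1, by simp, by linarith⟩
    have : ∀ i ∈ Set.Iio n, ∀ᶠ s in nhdsWithin (x.2 / x.1) {x.2 / x.1}ᶜ, s ≠ -a i / b i ∧
        (a i * x.1 + b i * x.2 ≠ 0 → 0 < (a i * x.1 + b i * x.2) * (ε * (a i + b i * s))) := by
      intro i _
      refine Filter.Eventually.and ?_ ?_
      · by_cases h : x.2 / x.1 = -a i / b i
        · rw [h]; exact self_mem_nhdsWithin
        · exact nhdsWithin_le_nhds (isOpen_ne.mem_nhds h)
      · by_cases h : a i * x.1 + b i * x.2 = 0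
        · simp [h]
        · have hc : ContinuousAt (fun s => (a i * x.1 + b i * x.2) * (ε * (a i + b i * s)))
              (x.2 / x.1) := by fun_prop
          have h0 : 0 < (a i * x.1 + b i * x.2) * (ε * (a i + b i * (x.2 / x.1))) := by
            have e : (a i * x.1 + b i * x.2) * (ε * (a i + b i * (x.2 / x.1))) =
                (a i * x.1 + b i * x.2) ^ 2 * (x.1 * ε) / x.1 ^ 2 := by field_simp
            rw [e]; positivity
          filter_upwards [nhdsWithin_le_nhds (hc.eventually (lt_mem_nhds h0))] with s hs _ using hs
    obtain ⟨s, hs⟩ := ((Set.finite_Iio n).eventually_all.mpr this).exists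
    exact ⟨s, ε, hε, hs⟩

/-- A positive product stays positive under the perturbation, so no hyperplane becomes crossed. Only
the product of the two signs matters, and it is put on the second point. -/
theorem exists_generic_le {x y : ℝ × ℝ} (hx : x ≠ 0) (hy : y ≠ 0) :
    ∃ s t ε : ℝ, (∀ i < n, s ≠ -a i / b i) ∧ (∀ i < n, t ≠ -c i / e i) ∧ (ε = 1 ∨ ε = -1) ∧
      crossCount n a b c e (1, s) (ε, ε * t) ≤ crossCount n a b c e x y := by
  obtain ⟨s, ε₁, hε₁, hs⟩ := exists_perturbation a b n hx
  obtain ⟨t, ε₂, hε₂, ht⟩ := exists_perturbation c e n hy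
  refine ⟨s, t, ε₁ * ε₂, fun i hi => (hs i hi).1, fun i hi => (ht i hi).1, ?_, ?_⟩
  · rcases hε₁ with rfl | rfl <;> rcases hε₂ with rfl | rfl <;> simp
  · refine Finset.card_le_card fun i hi => ?_
    rw [Finset.mem_filter, Finset.mem_range] at hi ⊢
    refine ⟨hi.1, ?_⟩
    by_contra! hpos
    have h1 := (hs i hi.1).2 (left_ne_zero_of_mul hpos.ne')
    have h2 := (ht i hi.1).2 (right_ne_zero_of_mul hpos.ne')
    have h3 : 0 < ((a i * x.1 + b i * x.2) * (c i * y.1 + e i * y.2)) *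
        ((a i * 1 + b i * s) * (c i * (ε₁ * ε₂) + e i * (ε₁ * ε₂ * t))) := by
      have := mul_pos h1 h2
      calc 0 < _ := this
        _ = _ := by ring
    have := (pos_iff_pos_of_mul_pos h3).mp hpos
    exact absurd hi.2 (not_le.mpr this)

/-- The cut rank is the least rank of an item whose key is at least `t`, or `N` if there is none.
With `exists_cut_rank`, rank cuts and real cuts induce the same divisions of the items. -/
theorem exists_rank_cut {κ : ℕ → ℝ} {ρ : ℕ → ℕ} {N : ℕ}
    (hρ : ∀ i < n, ρ i < N ∧ ∀ j < n, ρ i < ρ j ↔ κ i < κ j) (t : ℝ) :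
    ∃ p ≤ N, ∀ i < n, ρ i < p ↔ κ i < t := by
  by_cases hA : ((Finset.range n).filter fun i => t ≤ κ i).Nonempty
  · obtain ⟨j, hj, hmin⟩ := Finset.exists_min_image _ ρ hA
    simp only [Finset.mem_filter, Finset.mem_range, and_imp] at hj hmin
    refine ⟨ρ j, (hρ j hj.1).1.le, fun i hi => ⟨fun h => ?_, fun h => ?_⟩⟩
    · by_contra! hti
      exact absurd (hmin i hi hti) (not_le.mpr h)
    · exact ((hρ i hi).2 j hj.1).mpr (h.trans_le hj.2)
  · refine ⟨N, le_rfl, fun i hi => iff_of_true (hρ i hi).1 ?_⟩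
    by_contra! hti
    exact hA ⟨i, by simpa using ⟨hi, hti⟩⟩

theorem exists_cut_rank {κ : ℕ → ℝ} {ρ : ℕ → ℕ} {N : ℕ}
    (hρ : ∀ i < n, ρ i < N ∧ ∀ j < n, ρ i < ρ j ↔ κ i < κ j) (p : ℕ) :
    ∃ t, ∀ i < n, ρ i < p ↔ κ i < t := by
  by_cases hA : ((Finset.range n).filter fun i => p ≤ ρ i).Nonempty
  · obtain ⟨j, hj, hmin⟩ := Finset.exists_min_image _ κ hA
    simp only [Finset.mem_filter, Finset.mem_range, and_imp] at hj hmin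
    refine ⟨κ j, fun i hi => ⟨fun h => ?_, fun h => ?_⟩⟩
    · exact ((hρ i hi).2 j hj.1).mp (h.trans_le hj.2)
    · by_contra! hpi
      exact absurd (hmin i hi hpi) (not_le.mpr h)
  · obtain ⟨M, hM⟩ := ((Finset.range n).image κ).bddAbove
    refine ⟨M + 1, fun i hi => iff_of_true ?_ ?_⟩
    · by_contra! hpi
      exact hA ⟨i, by simpa using ⟨hi, hpi⟩⟩
    · exact (hM (by simpa using ⟨i, hi, rfl⟩)).trans_lt (lt_add_one M)

theorem splitSum_cutWeight {ρ : ℕ → ℕ} {s t : ℝ} {p : ℕ} (h : ∀ i < n, ρ i < p ↔ -c i / e i < t) :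
    splitSum n ρ (fun i => lexSign (-e i) (c i)) (fun i => lexSign (e i) (c i))
      (cutWeight (fun i => -a i / b i) (fun i => lexSign (-b i) (a i)) (fun i => lexSign (b i) (a i)) s)
      p = signSum n a b c e s t := by
  refine Finset.sum_congr rfl fun i hi => ?_
  rw [Finset.mem_range] at hi
  simp only [h i hi]

/-- The recorded best value belongs to some cuts, which can be moved to generic parameters without
changing `signSum`; this realizes `m`. Any other pair is first made generic and then compared with
the maximum. -/
theorem isLeast_crossCount {ρ : ℕ → ℕ} {N : ℕ} {best : ℝ}
    (hρ : ∀ i < n, ρ i < N ∧ ∀ j < n, ρ i < ρ j ↔ -c i / e i < -c j / e j)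
    (hbest : IsBest n N ρ (fun i => lexSign (-e i) (c i)) (fun i => lexSign (e i) (c i))
      (fun i => -a i / b i) (fun i => lexSign (-b i) (a i)) (fun i => lexSign (b i) (a i))
      Set.univ best) :
    ∃ m : ℕ, (m : ℝ) = ∑ i ∈ Finset.range n, (1 - lexSign (-b i) (a i) * lexSign (-e i) (c i) *
        (lexSign (-b i) (a i) * lexSign (-e i) (c i)) / 2) - best / 2 ∧ m ≤ n ∧
      IsLeast {m | ∃ x y : ℝ × ℝ, x ≠ 0 ∧ y ≠ 0 ∧ m = crossCount n a b c e x y} m := by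
  obtain ⟨s, ε, t, hε, hb⟩ : ∃ s ε t : ℝ, (ε = 1 ∨ ε = -1) ∧ best = ε * signSum n a b c e s t := by
    obtain ⟨⟨s, p, -, hb⟩, -⟩ := hbest
    obtain ⟨t, ht⟩ := exists_cut_rank hρ p
    rw [splitSum_cutWeight ht] at hb
    rcases hb with hb | hb
    · exact ⟨s, 1, t, by simp, by simpa using hb⟩
    · exact ⟨s, -1, t, by simp, by simpa using hb⟩
  obtain ⟨s', hs'⟩ := exists_generic (fun i => -a i / b i) n s
  obtain ⟨t', ht'⟩ := exists_generic (fun i => -c i / e i) n t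
  have hst : signSum n a b c e s' t' = signSum n a b c e s t := by
    refine Finset.sum_congr rfl fun i hi => ?_
    rw [Finset.mem_range] at hi
    simp only [cutWeight, (hs' i hi).2, (ht' i hi).2]
  have hgen := crossCount_generic (fun i hi => (hs' i hi).1) (fun i hi => (ht' i hi).1) hε
  rw [hst] at hgen
  have hm : (crossCount n a b c e (1, s') (ε, ε * t') : ℝ) =
      ∑ i ∈ Finset.range n, (1 - lexSign (-b i) (a i) * lexSign (-e i) (c i) *
        (lexSign (-b i) (a i) * lexSign (-e i) (c i)) / 2) - best / 2 := by
    rw [hgen, hb]; ring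
  refine ⟨_, hm, ?_, ⟨_, _, ?_, ?_, rfl⟩, ?_⟩
  · exact (Finset.card_filter_le _ _).trans (by simp)
  · simp [Prod.ext_iff]
  · rcases hε with rfl | rfl <;> simp [Prod.ext_iff]
  · rintro _ ⟨x, y, hx, hy, rfl⟩
    obtain ⟨s₁, t₁, ε₁, hs₁, ht₁, hε₁, hle⟩ := exists_generic_le (n := n) (a := a) (b := b) (c := c)
      (e := e) hx hy
    refine le_trans ?_ hle
    rw [← Nat.cast_le (α := ℝ), hm, crossCount_generic hs₁ ht₁ hε₁]
    obtain ⟨p, hp, hpt⟩ := exists_rank_cut hρ t₁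
    have := hbest.2 s₁ trivial p hp
    rw [splitSum_cutWeight hpt, abs_le] at this
    rcases hε₁ with rfl | rfl <;> linarith

end Forms

theorem IsBest.congr {n N : ℕ} {ρ : ℕ → ℕ} {β β' κ α α' β₁ β₁' κ₁ α₁ α₁' : ℕ → ℝ} {S : Set ℝ} {b : ℝ}
    (h : IsBest n N ρ β β' κ α α' S b)
    (e : ∀ i < n, β i = β₁ i ∧ β' i = β₁' i ∧ κ i = κ₁ i ∧ α i = α₁ i ∧ α' i = α₁' i) :
    IsBest n N ρ β₁ β₁' κ₁ α₁ α₁' S b := by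
  have : ∀ σ p, splitSum n ρ β β' (cutWeight κ α α' σ) p =
      splitSum n ρ β₁ β₁' (cutWeight κ₁ α₁ α₁' σ) p := by
    intro σ p
    refine Finset.sum_congr rfl fun i hi => ?_
    obtain ⟨e1, e2, e3, e4, e5⟩ := e i (Finset.mem_range.mp hi)
    simp only [cutWeight, e1, e2, e3, e4, e5]
  simpa only [IsBest, this] using h

/-! ### The program that minimizes the crossing count. -/

namespace RealRAM

/-- Assign the lexicographic sign of two values. -/
def setLexSign (A : ℕ) (i : NatExpr) (x y : RealExpr) : Program :=
  .ite (.realLt x (.const 0)) (.setReal A i (.const (-1)))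
    (.ite (.realLt (.const 0) x) (.setReal A i (.const 1))
      (.ite (.realLt y (.const 0)) (.setReal A i (.const (-1)))
        (.ite (.realLt (.const 0) y) (.setReal A i (.const 1)) (.setReal A i (.const 0)))))

@[simp] theorem exec_setLexSign (A : ℕ) (i : NatExpr) (x y : RealExpr) (s : Memory) :
    (setLexSign A i x y).exec s = s.setReal A (i.eval s) (lexSign (x.eval s) (y.eval s)) := by
  simp only [setLexSign, Program.exec, Cond.Holds, RealExpr.eval, Rat.cast_zero, Rat.cast_one,
    Rat.cast_neg, lexSign]
  by_cases h1 : x.eval s < 0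
  · simp only [h1, if_true]
  · by_cases h2 : 0 < x.eval s
    · simp only [h1, h2, if_true, if_false]
    · by_cases h3 : y.eval s < 0
      · simp only [h1, h2, h3, if_true, if_false]
      · by_cases h4 : 0 < y.eval s
        · simp only [h1, h2, h3, h4, if_true, if_false]
        · simp only [h1, h2, h3, h4, if_false]

/-- Compute the roots of the linear forms with coefficients in `real 2, …, real 5`, and the signs to
the left and to the right of the roots. -/
def classify : Program :=
  forLoop 1
    (.seq (setLexSign 6 (.get 1 (.const 0)) (.sub (.const 0) (.get 3 (.get 1 (.const 0))))
      (.get 2 (.get 1 (.const 0))))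
    (.seq (setLexSign 7 (.get 1 (.const 0)) (.get 3 (.get 1 (.const 0))) (.get 2 (.get 1 (.const 0))))
    (.seq (setLexSign 8 (.get 1 (.const 0)) (.sub (.const 0) (.get 5 (.get 1 (.const 0))))
      (.get 4 (.get 1 (.const 0))))
    (.seq (setLexSign 9 (.get 1 (.const 0)) (.get 5 (.get 1 (.const 0))) (.get 4 (.get 1 (.const 0))))
    (.seq (.setReal 10 (.get 1 (.const 0)) (.div (.sub (.const 0) (.get 2 (.get 1 (.const 0))))
      (.get 3 (.get 1 (.const 0)))))
    (.setReal 11 (.get 1 (.const 0)) (.div (.sub (.const 0) (.get 4 (.get 1 (.const 0))))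
      (.get 5 (.get 1 (.const 0))))))))))

theorem Spec.classify {n : ℕ} {a b c e : ℕ → ℝ} {s : Memory} (hn : s.nat 0 0 = n)
    (h2 : ∀ i < n, s.real 2 i = a i) (h3 : ∀ i < n, s.real 3 i = b i)
    (h4 : ∀ i < n, s.real 4 i = c i) (h5 : ∀ i < n, s.real 5 i = e i) :
    Spec RealRAM.classify s ((n + 1) * 400) fun s' => ∀ i < n,
      s'.real 8 i = lexSign (-e i) (c i) ∧ s'.real 9 i = lexSign (e i) (c i) ∧
      s'.real 10 i = -a i / b i ∧
      s'.real 6 i = lexSign (-b i) (a i) ∧ s'.real 7 i = lexSign (b i) (a i) ∧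
      s'.real 11 i = -c i / e i := by
  refine (Spec.forLoop (n := n) (T := 380) (fun k s => ((∀ i < n, s.real 2 i = a i) ∧
      (∀ i < n, s.real 3 i = b i) ∧ (∀ i < n, s.real 4 i = c i) ∧ ∀ i < n, s.real 5 i = e i) ∧
      ∀ i < k, s.real 8 i = lexSign (-e i) (c i) ∧ s.real 9 i = lexSign (e i) (c i) ∧
      s.real 10 i = -a i / b i ∧
      s.real 6 i = lexSign (-b i) (a i) ∧ s.real 7 i = lexSign (b i) (a i) ∧
      s.real 11 i = -c i / e i) one_ne_zero (by decide) (by decide) ?_ hn ?_).mono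
      (by lia) fun _ h => h.2
  · rintro k s hkn h1 h0 ⟨⟨h2, h3, h4, h5⟩, hall⟩
    refine (Spec.exec rfl ⟨⟨?_, ?_, ?_, ?_⟩, fun i hi => ?_⟩).mono (by decide) fun _ h => h
    · simpa using h2
    · simpa using h3
    · simpa using h4
    · simpa using h5
    · rcases Nat.lt_succ_iff_lt_or_eq.mp hi with hi | rfl
      · simpa [h1, Function.update_of_ne hi.ne] using hall i hi
      · simp [h1, h2 i hkn, h3 i hkn, h4 i hkn, h5 i hkn]
  · exact ⟨⟨h2, h3, h4, h5⟩, by simp⟩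

/-- Compute the least power of two that is at least `nat 0 0`. -/
def capacity : Program :=
  .seq (.setNat 3 (.const 0) (.const 1))
    (.while (.natLt (.get 3 (.const 0)) (.get 0 (.const 0)))
      (.setNat 3 (.const 0) (.add (.get 3 (.const 0)) (.get 3 (.const 0)))))

/-- For the time, the crude linear measure suffices; the bound `K ≤ Nat.clog 2 n` is what the tree
costs depend on. -/
theorem Spec.capacity {n : ℕ} {s : Memory} (hn : s.nat 0 0 = n) :
    Spec RealRAM.capacity s ((n + 1) * 20) fun s' =>
      ∃ K ≤ Nat.clog 2 n, s'.nat 3 0 = 2 ^ K ∧ n ≤ 2 ^ K := by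
  refine (Spec.seq (Spec.exec rfl ((Spec.while (T := 7)
    (fun s => s.nat 0 0 = n ∧ ∃ K ≤ Nat.clog 2 n, s.nat 3 0 = 2 ^ K)
    (fun s => n - s.nat 3 0) ?_ ?_).mono (T' := n * 14 + 6) ?_ ?_))).mono ?_ fun _ h => h
  · rintro s ⟨hn, K, hK, h3⟩ hc
    simp only [Cond.Holds, NatExpr.eval, hn] at hc
    refine Spec.exec rfl ⟨⟨by simpa using hn, K + 1, ?_, ?_⟩, ?_⟩
    · exact (Nat.lt_clog_iff_pow_lt (by lia)).mpr (h3 ▸ hc)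
    · simp [h3, pow_succ, mul_two]
    · have : 0 < s.nat 3 0 := h3 ▸ by positivity
      simp
      lia
  · exact ⟨by simpa using hn, 0, by lia, by simp⟩
  · simp only [Cond.cost, NatExpr.cost]
    have := Nat.sub_le n (((Program.setNat 3 (.const 0) (.const 1)).exec s).nat 3 0)
    have := Nat.mul_le_mul_right 13 this
    lia
  · rintro s' ⟨⟨hn, K, hK, h3⟩, hc⟩
    simp only [Cond.Holds, NatExpr.eval, hn, not_lt] at hc
    exact ⟨K, hK, h3, h3 ▸ hc⟩
  · simp only [Program.bound, NatExpr.cost]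
    lia

/-- Put the natural number that equals `real 17 0 - real 16 0 / 2` into `nat 0 0`. -/
def convert : Program :=
  .seq (.setNat 0 (.const 0) (.const 0))
    (.seq (.setReal 20 (.const 0) (.const 0))
      (.while (.realLt (.get 20 (.const 0)) (.sub (.get 17 (.const 0))
          (.div (.get 16 (.const 0)) (.const 2))))
        (.seq (.setNat 0 (.const 0) (.add (.get 0 (.const 0)) (.const 1)))
          (.setReal 20 (.const 0) (.add (.get 20 (.const 0)) (.const 1))))))

/-- Without rounding, the integer is reached by a real and a natural counter that advance together.
This is affordable because the result is at most `n`. -/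
theorem Spec.convert {m : ℕ} {s : Memory} (h : (m : ℝ) = s.real 17 0 - s.real 16 0 / 2) :
    Spec RealRAM.convert s ((m + 1) * 40) fun s' => s'.nat 0 0 = m := by
  refine (Spec.seq (Spec.exec rfl (Spec.seq (Spec.exec rfl ((Spec.while (T := 12)
    (fun s => s.real 17 0 - s.real 16 0 / 2 = m ∧ s.real 20 0 = s.nat 0 0 ∧ s.nat 0 0 ≤ m)
    (fun s => m - s.nat 0 0) ?_ ?_).mono (T' := m * 30 + 15) ?_ ?_))))).mono ?_ fun _ h => h
  · rintro s ⟨hm, h20, hle⟩ hc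
    simp only [Cond.Holds, NatExpr.eval, RealExpr.eval, Rat.cast_ofNat, hm, h20, Nat.cast_lt] at hc
    refine Spec.exec rfl ⟨⟨by simpa using hm, by simp [h20], by simpa using hc⟩, ?_⟩
    simp
    lia
  · exact ⟨by simpa using h.symm, by simp, by simp⟩
  · simp [Cond.cost, NatExpr.cost, RealExpr.cost]
    lia
  · rintro s' ⟨⟨hm, h20, hle⟩, hc⟩
    simp only [Cond.Holds, NatExpr.eval, RealExpr.eval, Rat.cast_ofNat, hm, h20, Nat.cast_lt] at hc
    lia
  · simp only [Program.bound, NatExpr.cost, RealExpr.cost]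
    lia

/-- Put the least value of `crossCount` for the linear forms with coefficients in
`real 2, …, real 5` into `nat 0 0`. -/
def minimize : Program :=
  .seq classify (.seq capacity (.seq (sort 10 7 8) (.seq (sort 11 12 9) (.seq rank
    (.seq loadAll (.seq sweep convert))))))

/-- The memory that `minimize` needs to be zero is zero. -/
def Clean (s : Memory) : Prop :=
  (∀ A ∈ [7, 12], s.nat A = fun _ => 0) ∧ ∀ A ∈ [12, 13, 14, 15, 17], s.real A = fun _ => 0

/-- The sweep runs over the roots in `real 10` of the first forms; the tree is indexed by the ranks
of the roots in `real 11` of the second forms. -/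
theorem Spec.minimize {n : ℕ} {a b c e : ℕ → ℝ} {s : Memory} (hn : s.nat 0 0 = n)
    (h2 : ∀ i < n, s.real 2 i = a i) (h3 : ∀ i < n, s.real 3 i = b i)
    (h4 : ∀ i < n, s.real 4 i = c i) (h5 : ∀ i < n, s.real 5 i = e i) (hs : Clean s) :
    Spec RealRAM.minimize s ((n + 1) * (Nat.clog 2 n + 1) * 2000) fun s' =>
      IsLeast {m | ∃ x y : ℝ × ℝ, x ≠ 0 ∧ y ≠ 0 ∧ m = crossCount n a b c e x y} (s'.nat 0 0) := by
  set C := Nat.clog 2 n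
  have mono : ∀ {K : ℕ}, K ≤ C → ∀ t, (n + 1) * (K + 1) * t ≤ (n + 1) * (C + 1) * t := fun hK t =>
    Nat.mul_le_mul_right _ (Nat.mul_le_mul_left _ (by lia))
  -- Zeroed memory is an empty tournament tree; each of the two sorts has its own.
  have zeroTree : ∀ (key : ℕ → ℝ) (N : ℕ), IsTree (minEntry key) N (fun _ => 0) (fun _ => 0) :=
    fun key N => ⟨fun _ _ _ => by simp [minEntry], fun _ _ => rfl⟩
  refine (Spec.seq (T := (n + 1) * 400) (T' := (n + 1) * (C + 1) * 1600)
    ((Spec.classify hn h2 h3 h4 h5).frame.mono le_rfl ?_)).mono (by ring_nf; lia) fun _ h => h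
  rintro s₁ ⟨hsig, fn₁, fr₁⟩
  refine (Spec.seq (T := (n + 1) * 20) (T' := (n + 1) * (C + 1) * 1580)
    ((Spec.capacity (n := n) (by rw [fn₁ 0 (by decide), hn])).frame.mono le_rfl ?_)).mono
      (by ring_nf; lia) fun _ h => h
  rintro s₂ ⟨⟨K, hK, hN, hnN⟩, fn₂, fr₂⟩
  refine (Spec.seq (T := (n + 1) * (C + 1) * 300) (T' := (n + 1) * (C + 1) * 1280)
    ((Spec.sort (n := n) (key := s₁.real 10) (by decide) (by decide) rfl hnN
      (by rw [fn₂ 0 (by decide), fn₁ 0 (by decide), hn]) hN (fr₂ 10 (by decide)) ?_).frame.mono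
        (mono hK _) ?_)).mono (by ring_nf; lia) fun _ h => h
  · rw [fn₂ 7 (by decide), fn₁ 7 (by decide), hs.1 7 (by decide)]
    exact zeroTree _ _
  rintro s₃ ⟨hO, fn₃, fr₃⟩
  refine (Spec.seq (T := (n + 1) * (C + 1) * 300) (T' := (n + 1) * (C + 1) * 980)
    ((Spec.sort (n := n) (key := s₁.real 11) (by decide) (by decide) rfl hnN
      (by rw [fn₃ 0 (by decide), fn₂ 0 (by decide), fn₁ 0 (by decide), hn])
      (by rw [fn₃ 3 (by decide), hN]) (by rw [fr₃ 11 (by decide), fr₂ 11 (by decide)]) ?_).frame.mono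
        (mono hK _) ?_)).mono (by ring_nf; lia) fun _ h => h
  · rw [fn₃ 12 (by decide), fn₂ 12 (by decide), fn₁ 12 (by decide), hs.1 12 (by decide)]
    exact zeroTree _ _
  rintro s₄ ⟨hO', fn₄, fr₄⟩
  refine (Spec.seq (T := (n + 1) * 60) (T' := (n + 1) * (C + 1) * 920)
    ((Spec.rank (n := n) (key := s₁.real 11)
      (by rw [fn₄ 0 (by decide), fn₃ 0 (by decide), fn₂ 0 (by decide), fn₁ 0 (by decide), hn])
      (by rw [fr₄ 11 (by decide), fr₃ 11 (by decide), fr₂ 11 (by decide)]) rfl hO').frame.mono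
        le_rfl ?_)).mono (by ring_nf; lia) fun _ h => h
  rintro s₅ ⟨hρ, fn₅, fr₅⟩
  have r₅ : ∀ A, A ∉ [6, 7, 8, 9, 10, 11] → s₅.real A = s.real A := by
    intro A hA
    rw [fr₅ A (by simp [RealRAM.rank, nextRank]), fr₄ A (by simp [RealRAM.sort,
      RealRAM.minUpdate, RealRAM.walkUp, minStep]), fr₃ A (by simp [RealRAM.sort,
      RealRAM.minUpdate, RealRAM.walkUp, minStep]), fr₂ A (by simp [RealRAM.capacity])]
    refine fr₁ A fun h => hA ?_
    have : RealRAM.classify.realWrites ⊆ [6, 7, 8, 9, 10, 11] := by decide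
    exact this h
  have r₅' : ∀ A, s₅.real A = s₁.real A := by
    intro A
    rw [fr₅ A (by simp [RealRAM.rank, nextRank]), fr₄ A (by simp [RealRAM.sort,
      RealRAM.minUpdate, RealRAM.walkUp, minStep]), fr₃ A (by simp [RealRAM.sort,
      RealRAM.minUpdate, RealRAM.walkUp, minStep]), fr₂ A (by simp [RealRAM.capacity])]
  have n₅ : s₅.nat 0 0 = n := by
    rw [fn₅ 0 (by decide), fn₄ 0 (by decide), fn₃ 0 (by decide), fn₂ 0 (by decide),
      fn₁ 0 (by decide), hn]
  have N₅ : s₅.nat 3 0 = 2 ^ K := by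
    rw [fn₅ 3 (by decide), fn₄ 3 (by decide), fn₃ 3 (by decide), hN]
  have zero₅ : ∀ A ∈ [12, 13, 14, 15, 17], s₅.real A = fun _ => 0 := fun A hA => by
    rw [r₅ A (by simp at hA ⊢; lia), hs.2 A hA]
  refine (Spec.seq (T := (n + 1) * (C + 1) * 300) (T' := (n + 1) * (C + 1) * 620)
    ((Spec.loadAll (n := n) (K := K) (ρ := s₅.nat 11) (α := s₁.real 6) (β := s₁.real 8)
      (β' := s₁.real 9) rfl (fun i hi => (hρ i hi).1.trans_le hnN) n₅ N₅ rfl (r₅' 6) (r₅' 8) (r₅' 9)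
      (by rw [zero₅ 17 (by decide)]) (Loaded.zero (zero₅ 12 (by decide)) (zero₅ 13 (by decide))
        (zero₅ 14 (by decide)) (zero₅ 15 (by decide)))).frame.mono
        (mono hK _) ?_)).mono (by ring_nf; lia) fun _ h => h
  rintro s₆ ⟨⟨hl, h17⟩, fn₆, fr₆⟩
  refine (Spec.seq (T := (n + 1) * (C + 1) * 500) (T' := (n + 1) * 40)
    ((Spec.sweep (n := n) (K := K) (ρ := s₅.nat 11) (O := s₃.nat 8) (α := s₁.real 6)
      (α' := s₁.real 7) (β := s₁.real 8) (β' := s₁.real 9) (key := s₁.real 10) rfl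
      (fun i hi => (hρ i hi).1.trans_le hnN)
      (by rw [fn₆ 0 (by decide), n₅]) (by rw [fn₆ 3 (by decide), N₅])
      (by rw [fn₆ 8 (by decide), fn₅ 8 (by decide), fn₄ 8 (by decide)]) hO
      (by rw [fn₆ 11 (by decide)]) (by rw [fr₆ 6 (by decide), r₅' 6])
      (by rw [fr₆ 7 (by decide), r₅' 7]) (by rw [fr₆ 8 (by decide), r₅' 8])
      (by rw [fr₆ 9 (by decide), r₅' 9]) (by rw [fr₆ 10 (by decide), r₅' 10]) hl).frame.mono
        (mono hK _) ?_)).mono (by ring_nf; lia) fun _ h => h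
  rintro s₇ ⟨hb, -, fr₇⟩
  obtain ⟨m, hm, hmn, hleast⟩ := isLeast_crossCount (n := n) (a := a) (b := b) (c := c) (e := e)
    (ρ := s₅.nat 11) (N := 2 ^ K) (best := s₇.real 16 0) (fun i hi =>
      ⟨(hρ i hi).1.trans_le hnN, fun j hj => by
        rw [(hρ i hi).2 j hj, (hsig i hi).2.2.2.2.2, (hsig j hj).2.2.2.2.2]⟩)
    (hb.congr fun i hi => ⟨(hsig i hi).1, (hsig i hi).2.1, (hsig i hi).2.2.1, (hsig i hi).2.2.2.1,
      (hsig i hi).2.2.2.2.1⟩)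
  refine (Spec.convert (m := m) ?_).mono (Nat.mul_le_mul_right _ (by lia)) ?_
  · rw [hm, fr₇ 17 (by decide), h17]
    congr 1
    refine Finset.sum_congr rfl fun i hi => ?_
    obtain ⟨h1, -, -, h2, -⟩ := hsig i (Finset.mem_range.mp hi)
    rw [h1, h2]
  · rintro s' rfl
    exact hleast

end RealRAM

/-! ### Crossings of segments as signs of products of linear forms. -/

namespace Arrangement

variable {d n : ℕ}

theorem not_nontrivial_seg_self {x : HVec d} : ¬ (seg x x).Nontrivial := by
  rw [Set.not_nontrivial_iff]
  rintro _ ⟨a, b, -, -, h, rfl⟩ _ ⟨a', b', -, -, h', rfl⟩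
  rw [Projectivization.mk_eq_mk_iff']
  rw [← add_smul] at h h'
  refine ⟨(a + b) / (a' + b'), ?_⟩
  rw [← add_smul, ← add_smul, smul_smul, div_mul_cancel₀]
  exact left_ne_zero_of_smul h'

theorem crossingDistance_eq_zero (H : Fin n → HVec d) {F₁ F₂ : Submodule ℝ (HVec d)} {x : HVec d}
    (h1 : x ∈ F₁) (h2 : x ∈ F₂) (hx : x ≠ 0) : crossingDistance H F₁ F₂ = 0 := by
  refine Nat.sInf_eq_zero.mpr (Or.inl ⟨x, h1, x, h2, hx, hx, ?_⟩)
  simp [crossings, Crosses, not_nontrivial_seg_self]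

theorem mk_mem_pointsOf_hyperplane {h v : HVec d} (hv : v ≠ 0) :
    Projectivization.mk ℝ v hv ∈ pointsOf (hyperplane h) ↔ h ⬝ᵥ v = 0 := by
  simp only [pointsOf, Set.mem_ofPred_eq, Projectivization.submodule_mk, Submodule.span_singleton_le_iff_mem]
  rfl

/-- On the nonnegative combinations of `x` and `y` the form `h` has a zero iff its values at the
ends do not have the same strict sign. -/
theorem crosses_seg_iff {x y h : HVec d} (hxy : LinearIndependent ℝ ![x, y]) :
    Crosses (seg x y) h ↔ (h ⬝ᵥ x) * (h ⬝ᵥ y) ≤ 0 := by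
  rw [LinearIndependent.pair_iff] at hxy
  have hne : ∀ a b : ℝ, (a ≠ 0 ∨ b ≠ 0) → a • x + b • y ≠ 0 := by
    intro a b hab h0
    obtain ⟨ha, hb⟩ := hxy a b h0
    simp [ha, hb] at hab
  have hnt : (seg x y).Nontrivial := by
    refine ⟨_, ⟨1, 0, by simp, by simp, hne 1 0 (by simp), rfl⟩, _,
      ⟨0, 1, by simp, by simp, hne 0 1 (by simp), rfl⟩, ?_⟩
    rw [Ne, Projectivization.mk_eq_mk_iff']
    rintro ⟨r, hr⟩
    have := (hxy 1 (-r) (by rw [neg_smul, add_neg_eq_zero]; simpa using hr.symm)).1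
    simp at this
  simp only [Crosses, hnt, true_and]
  constructor
  · rintro ⟨_, ⟨a, b, ha, hb, hv, rfl⟩, hp⟩
    rw [mk_mem_pointsOf_hyperplane, dotProduct_add, dotProduct_smul, dotProduct_smul, smul_eq_mul,
      smul_eq_mul] at hp
    by_contra! hpos
    have hab : a ≠ 0 ∨ b ≠ 0 := by
      by_contra! h0
      simp [h0.1, h0.2] at hv
    rcases pos_and_pos_or_neg_and_neg_of_mul_pos hpos with ⟨h1, h2⟩ | ⟨h1, h2⟩
    · have p1 := mul_nonneg ha h1.le
      have p2 := mul_nonneg hb h2.le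
      rcases hab with h0 | h0
      · have := mul_pos (ha.lt_of_ne' h0) h1; linarith
      · have := mul_pos (hb.lt_of_ne' h0) h2; linarith
    · have p1 := mul_nonpos_of_nonneg_of_nonpos ha h1.le
      have p2 := mul_nonpos_of_nonneg_of_nonpos hb h2.le
      rcases hab with h0 | h0
      · have := mul_neg_of_pos_of_neg (ha.lt_of_ne' h0) h1; linarith
      · have := mul_neg_of_pos_of_neg (hb.lt_of_ne' h0) h2; linarith
  · intro hle
    by_cases hx : h ⬝ᵥ x = 0
    · refine ⟨_, ⟨1, 0, by simp, by simp, hne 1 0 (by simp), rfl⟩, ?_⟩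
      rw [mk_mem_pointsOf_hyperplane]
      simpa using hx
    -- With these coefficients the two contributions have equal modulus and opposite signs.
    · refine ⟨_, ⟨|h ⬝ᵥ y|, |h ⬝ᵥ x|, abs_nonneg _, abs_nonneg _, hne _ _ (by simp [hx]), rfl⟩, ?_⟩
      rw [mk_mem_pointsOf_hyperplane, dotProduct_add, dotProduct_smul, dotProduct_smul, smul_eq_mul,
        smul_eq_mul]
      rcases mul_nonpos_iff.mp hle with ⟨h1, h2⟩ | ⟨h1, h2⟩
      · rw [abs_of_nonneg h1, abs_of_nonpos h2]; ring
      · rw [abs_of_nonpos h1, abs_of_nonneg h2]; ring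

/-- The crossing distance between two lines that do not meet, in terms of pairs of linear forms. -/
theorem crossingDistance_eq {H : Fin n → HVec d} {u u' v v' : HVec d} {a b c e : ℕ → ℝ} {m : ℕ}
    (hu : LinearIndependent ℝ ![u, u']) (hv : LinearIndependent ℝ ![v, v'])
    (hdisj : ∀ x ∈ Submodule.span ℝ {u, u'}, x ∈ Submodule.span ℝ {v, v'} → x = 0)
    (ha : ∀ i : Fin n, a i = H i ⬝ᵥ u) (hb : ∀ i : Fin n, b i = H i ⬝ᵥ u')
    (hc : ∀ i : Fin n, c i = H i ⬝ᵥ v) (he : ∀ i : Fin n, e i = H i ⬝ᵥ v')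
    (hm : IsLeast {m | ∃ x y : ℝ × ℝ, x ≠ 0 ∧ y ≠ 0 ∧ m = crossCount n a b c e x y} m) :
    crossingDistance H (Submodule.span ℝ {u, u'}) (Submodule.span ℝ {v, v'}) = m := by
  have hcount : ∀ x y : ℝ × ℝ, x.1 • u + x.2 • u' ≠ 0 → y.1 • v + y.2 • v' ≠ 0 →
      crossings H (seg (x.1 • u + x.2 • u') (y.1 • v + y.2 • v')) = crossCount n a b c e x y := by
    intro x y hx hy
    have hli : LinearIndependent ℝ ![x.1 • u + x.2 • u', y.1 • v + y.2 • v'] := by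
      rw [LinearIndependent.pair_iff]
      intro s t hst
      have h1 : s • (x.1 • u + x.2 • u') ∈ Submodule.span ℝ {u, u'} :=
        Submodule.smul_mem _ _ (Submodule.mem_span_pair.mpr ⟨_, _, rfl⟩)
      have h2 : s • (x.1 • u + x.2 • u') ∈ Submodule.span ℝ {v, v'} := by
        rw [eq_neg_of_add_eq_zero_left hst]
        exact Submodule.neg_mem _ (Submodule.smul_mem _ _ (Submodule.mem_span_pair.mpr ⟨_, _, rfl⟩))
      have h3 := hdisj _ h1 h2
      rw [h3, zero_add] at hst
      exact ⟨(smul_eq_zero.mp h3).resolve_right hx, (smul_eq_zero.mp hst).resolve_right hy⟩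
    have himg : Fin.val '' {i : Fin n | Crosses (seg (x.1 • u + x.2 • u') (y.1 • v + y.2 • v')) (H i)} =
        ((Finset.range n).filter fun i =>
          (a i * x.1 + b i * x.2) * (c i * y.1 + e i * y.2) ≤ 0 : Finset ℕ) := by
      ext i
      simp only [crosses_seg_iff hli, dotProduct_add, dotProduct_smul, smul_eq_mul, Set.mem_image,
        Set.mem_ofPred_eq, Finset.coe_filter, Finset.mem_range]
      constructor
      · rintro ⟨j, hj, rfl⟩
        refine ⟨j.2, ?_⟩
        rw [ha, hb, hc, he]
        linarith
      · rintro ⟨hi, hj⟩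
        refine ⟨⟨i, hi⟩, ?_, rfl⟩
        rw [← ha, ← hb, ← hc, ← he]
        linarith
    rw [crossings, ← Set.ncard_image_of_injective _ Fin.val_injective, himg, Set.ncard_coe_finset]
    rfl
  have hne : ∀ {w w' : HVec d}, LinearIndependent ℝ ![w, w'] → ∀ x : ℝ × ℝ,
      x ≠ 0 ↔ x.1 • w + x.2 • w' ≠ 0 := by
    intro w w' hw x
    rw [LinearIndependent.pair_iff] at hw
    refine not_congr ⟨fun h => by simp [h], fun h => ?_⟩
    obtain ⟨h1, h2⟩ := hw _ _ h
    exact Prod.ext h1 h2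
  suffices hset : {m | ∃ x ∈ Submodule.span ℝ {u, u'}, ∃ y ∈ Submodule.span ℝ {v, v'},
      x ≠ 0 ∧ y ≠ 0 ∧ m = crossings H (seg x y)} =
      {m | ∃ x y : ℝ × ℝ, x ≠ 0 ∧ y ≠ 0 ∧ m = crossCount n a b c e x y} by
    rw [crossingDistance, hset]
    exact hm.csInf_eq
  ext k
  constructor
  · rintro ⟨x, hx, y, hy, hx0, hy0, rfl⟩
    obtain ⟨x1, x2, rfl⟩ := Submodule.mem_span_pair.mp hx
    obtain ⟨y1, y2, rfl⟩ := Submodule.mem_span_pair.mp hy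
    exact ⟨(x1, x2), (y1, y2), (hne hu _).mpr hx0, (hne hv _).mpr hy0, hcount (x1, x2) (y1, y2) hx0 hy0⟩
  · rintro ⟨x, y, hx, hy, rfl⟩
    exact ⟨_, Submodule.mem_span_pair.mpr ⟨x.1, x.2, rfl⟩, _,
      Submodule.mem_span_pair.mpr ⟨y.1, y.2, rfl⟩, (hne hu x).mp hx, (hne hv y).mp hy,
      (hcount x y ((hne hu x).mp hx) ((hne hv y).mp hy)).symm⟩

/-- The Gram matrix is singular iff the four vectors are dependent. As each pair is independent, a
dependence is a common nonzero vector of the two planes. -/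
theorem det_gram_eq_zero_iff {u u' v v' : HVec d} (hu : LinearIndependent ℝ ![u, u'])
    (hv : LinearIndependent ℝ ![v, v']) :
    (Matrix.of ![u, u', v, v'] * (Matrix.of ![u, u', v, v'])ᵀ).det = 0 ↔
      ∃ x ∈ Submodule.span ℝ {u, u'}, x ∈ Submodule.span ℝ {v, v'} ∧ x ≠ 0 := by
  set M : Matrix (Fin 4) (Fin (d + 1)) ℝ := Matrix.of ![u, u', v, v'] with hM
  have hvec : ∀ g : Fin 4 → ℝ, g ᵥ* M = g 0 • u + g 1 • u' + g 2 • v + g 3 • v' := by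
    intro g
    ext j
    simp [hM, Matrix.vecMul, dotProduct, Fin.sum_univ_four]
  rw [LinearIndependent.pair_iff] at hu hv
  rw [← Matrix.exists_vecMul_eq_zero_iff]
  constructor
  · rintro ⟨g, hg, h⟩
    -- The squared norm of this vector is the value of the Gram form at `g`, which vanishes.
    have h0 : g ᵥ* M = 0 := by
      rw [← dotProduct_self_eq_zero]
      nth_rewrite 2 [← Matrix.mulVec_transpose]
      rw [Matrix.dotProduct_mulVec, Matrix.vecMul_vecMul, h, zero_dotProduct]
    rw [hvec] at h0
    have hx : g 0 • u + g 1 • u' = -(g 2 • v + g 3 • v') := by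
      rw [eq_neg_iff_add_eq_zero, ← h0]; abel
    refine ⟨g 0 • u + g 1 • u', Submodule.mem_span_pair.mpr ⟨_, _, rfl⟩, ?_, fun hz => hg ?_⟩
    · rw [hx]
      exact Submodule.neg_mem _ (Submodule.mem_span_pair.mpr ⟨_, _, rfl⟩)
    · obtain ⟨e0, e1⟩ := hu _ _ hz
      rw [hz, eq_comm, neg_eq_zero] at hx
      obtain ⟨e2, e3⟩ := hv _ _ hx
      funext i
      fin_cases i <;> assumption
  · rintro ⟨x, hx, hx', hx0⟩
    obtain ⟨α, β, rfl⟩ := Submodule.mem_span_pair.mp hx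
    obtain ⟨γ, δ, h⟩ := Submodule.mem_span_pair.mp hx'
    refine ⟨![α, β, -γ, -δ], fun hg => hx0 ?_, ?_⟩
    · have h0 := congrFun hg 0
      have h1 := congrFun hg 1
      simp at h0 h1
      simp [h0, h1]
    · have h0 : ![α, β, -γ, -δ] ᵥ* M = 0 := by
        rw [hvec]
        change α • u + β • u' + -γ • v + -δ • v' = 0
        rw [← h]
        module
      rw [← Matrix.vecMul_vecMul, h0, Matrix.zero_vecMul]

end Arrangement

/-! ### Explicit dual lines for the regression depth. -/

namespace Arrangement

variable {n : ℕ}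

theorem mem_dualFlat_completion_pair {d : ℕ} {p q : Fin d → ℝ} {z : HVec d} :
    z ∈ dualFlat (completion (affineSpan ℝ {p, q})) ↔ z ⬝ᵥ homog p = 0 ∧ z ⬝ᵥ homog q = 0 := by
  constructor
  · intro h
    exact ⟨h _ (Submodule.subset_span ⟨p, left_mem_affineSpan_pair ℝ p q, rfl⟩),
      h _ (Submodule.subset_span ⟨q, right_mem_affineSpan_pair ℝ p q, rfl⟩)⟩
  · rintro ⟨hp, hq⟩
    have hle : completion (affineSpan ℝ {p, q}) ≤ hyperplane z := by
      refine Submodule.span_le.mpr ?_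
      rintro _ ⟨x, hx, rfl⟩
      obtain ⟨r, rfl⟩ := mem_affineSpan_pair_iff_exists_lineMap_eq.mp hx
      have e : homog (AffineMap.lineMap p q r) = (1 - r) • homog p + r • homog q := by
        funext i
        refine Fin.lastCases ?_ (fun i => ?_) i
        · simp [homog]
        · simp [homog, AffineMap.lineMap_apply]; ring
      change z ⬝ᵥ _ = 0
      rw [e, dotProduct_add, dotProduct_smul, dotProduct_smul, hp, hq]
      simp
    exact fun v hv => hle hv

theorem dotProduct_homog_three (z : HVec 3) (x : Fin 3 → ℝ) :
    z ⬝ᵥ homog x = z 0 * x 0 + z 1 * x 1 + z 2 * x 2 + z 3 := by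
  have e : homog x = ![x 0, x 1, x 2, 1] := by
    funext i
    fin_cases i <;> rfl
  rw [e]
  simp [dotProduct, Fin.sum_univ_four]

theorem dualFlat_responseAtInfinity :
    dualFlat (responseAtInfinity 3 1) = Submodule.span ℝ {![1, 0, 0, 0], ![0, 0, 0, 1]} := by
  ext z
  rw [Submodule.mem_span_pair]
  constructor
  · intro h
    have h1 := h ![0, 1, 0, 0] ⟨rfl, fun i hi => by
      obtain rfl : i = 0 := by ext; simpa using hi
      rfl⟩
    have h2 := h ![0, 0, 1, 0] ⟨rfl, fun i hi => by
      obtain rfl : i = 0 := by ext; simpa using hi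
      rfl⟩
    simp [dotProduct, Fin.sum_univ_four] at h1 h2
    refine ⟨z 0, z 3, ?_⟩
    funext i
    fin_cases i <;> simp [h1, h2]
  · rintro ⟨a, b, rfl⟩ w ⟨h3, h0⟩
    have h0 : w 0 = 0 := h0 0 (by simp)
    have h3 : w 3 = 0 := h3
    simp [dotProduct, Fin.sum_univ_four, h0, h3]

/-- If `q 0 ≠ p 0`, the planes through both points are parametrized by their two response
coefficients; the other two coordinates are solved for. The basis is scaled to avoid denominators.
-/
theorem dualFlat_completion_pair {p q : Fin 3 → ℝ} (h : q 0 - p 0 ≠ 0) :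
    dualFlat (completion (affineSpan ℝ {p, q})) = Submodule.span ℝ
      {![-(q 1 - p 1), q 0 - p 0, 0, (q 1 - p 1) * p 0 - (q 0 - p 0) * p 1],
        ![-(q 2 - p 2), 0, q 0 - p 0, (q 2 - p 2) * p 0 - (q 0 - p 0) * p 2]} := by
  ext z
  rw [Submodule.mem_span_pair, mem_dualFlat_completion_pair, dotProduct_homog_three,
    dotProduct_homog_three]
  constructor
  · rintro ⟨hp, hq⟩
    refine ⟨z 1 / (q 0 - p 0), z 2 / (q 0 - p 0), ?_⟩
    have h0 : z 0 * (q 0 - p 0) = -(z 1 * (q 1 - p 1) + z 2 * (q 2 - p 2)) := by linarith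
    have e0 : z 0 = -(z 1 * (q 1 - p 1) + z 2 * (q 2 - p 2)) / (q 0 - p 0) := by
      rw [← h0, mul_div_cancel_right₀ _ h]
    have e3 : z 3 = -(z 0 * p 0 + z 1 * p 1 + z 2 * p 2) := by linarith
    funext i
    fin_cases i
    · simp [e0]; ring
    · simp [h]
    · simp [h]
    · simp only [Fin.reduceFinMk, Pi.add_apply, Pi.smul_apply, smul_eq_mul, Matrix.cons_val]
      rw [e3, e0]
      field_simp
      ring
  · rintro ⟨a, b, rfl⟩
    constructor <;> simp <;> ring

/-- The regression depth of the line through `p` and `q`, as the least crossing count of the linear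
forms that the data points define on the dual line (`a`, `b`) and at vertical infinity (`c`, `e`). -/
theorem regressionDepth_eq {pts : Fin n → Fin 3 → ℝ} {p q : Fin 3 → ℝ} (h : q 0 - p 0 ≠ 0)
    {a b c e : ℕ → ℝ} {m : ℕ}
    (ha : ∀ i : Fin n, a i = (q 0 - p 0) * (pts i 1 - p 1) - (q 1 - p 1) * (pts i 0 - p 0))
    (hb : ∀ i : Fin n, b i = (q 0 - p 0) * (pts i 2 - p 2) - (q 2 - p 2) * (pts i 0 - p 0))
    (hc : ∀ i : Fin n, c i = pts i 0) (he : ∀ i : Fin n, e i = 1)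
    (hm : IsLeast {m | ∃ x y : ℝ × ℝ, x ≠ 0 ∧ y ≠ 0 ∧ m = crossCount n a b c e x y} m) :
    regressionDepth 1 pts (affineSpan ℝ {p, q}) = m := by
  rw [regressionDepth, dualFlat_completion_pair h, dualFlat_responseAtInfinity]
  refine crossingDistance_eq (a := a) (b := b) (c := c) (e := e) ?_ ?_ ?_ ?_ ?_ ?_ ?_ hm
  · rw [LinearIndependent.pair_iff]
    intro s t hst
    have h1 := congrFun hst 1
    have h2 := congrFun hst 2
    simp [h] at h1 h2
    exact ⟨h1, h2⟩
  · rw [LinearIndependent.pair_iff]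
    intro s t hst
    have h1 := congrFun hst 0
    have h2 := congrFun hst 3
    simp at h1 h2
    exact ⟨h1, h2⟩
  · intro x h1 h2
    obtain ⟨α, β, rfl⟩ := Submodule.mem_span_pair.mp h1
    obtain ⟨γ, δ, hγ⟩ := Submodule.mem_span_pair.mp h2
    have e1 := congrFun hγ 1
    have e2 := congrFun hγ 2
    simp [h] at e1 e2
    rw [e1, e2]
    simp
  · intro i
    rw [dotProduct_comm, dotProduct_homog_three, ha]
    simp
    ring
  · intro i
    rw [dotProduct_comm, dotProduct_homog_three, hb]
    simp
    ring
  · intro i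
    rw [dotProduct_comm, dotProduct_homog_three, hc]
    simp
  · intro i
    rw [dotProduct_comm, dotProduct_homog_three, he]
    simp

/-- The vertical plane on which the explanatory coordinate equals `p 0` contains both the line and
the line at vertical infinity, so it is a common point of the duals. -/
theorem regressionDepth_eq_zero {pts : Fin n → Fin 3 → ℝ} {p q : Fin 3 → ℝ} (h : q 0 - p 0 = 0) :
    regressionDepth 1 pts (affineSpan ℝ {p, q}) = 0 := by
  rw [regressionDepth]
  refine crossingDistance_eq_zero _ (x := ![1, 0, 0, -p 0]) ?_ ?_ ?_
  · rw [mem_dualFlat_completion_pair, dotProduct_homog_three, dotProduct_homog_three]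
    simpa [sub_eq_add_neg] using h
  · rw [dualFlat_responseAtInfinity, Submodule.mem_span_pair]
    refine ⟨1, -p 0, ?_⟩
    funext i
    fin_cases i <;> simp
  · intro h0
    have := congrFun h0 0
    simp at this

end Arrangement

/-! ### Reading the input: dot products and the Gram determinant. -/

namespace RealRAM

theorem rowMajor_apply {m w : ℕ} (M : Fin m → Fin w → ℝ) (i : Fin m) (j : Fin w) :
    rowMajor M (i * w + j) = M i j := by
  have hlt : (i : ℕ) * w + j < m * w := by
    calc (i : ℕ) * w + j < i * w + w := by lia
      _ = (i + 1) * w := by ring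
      _ ≤ m * w := Nat.mul_le_mul_right _ i.2
  rw [rowMajor, dif_pos hlt]
  congr 1
  · ext
    change ((i : ℕ) * w + j) / w = i
    rw [mul_comm, Nat.mul_add_div (by have := j.2; lia), Nat.div_eq_of_lt j.2, add_zero]
  · ext
    change ((i : ℕ) * w + j) % w = j
    rw [mul_comm, Nat.mul_add_mod, Nat.mod_eq_of_lt j.2]

/-- The dot product of two blocks of `m` numbers. -/
def dotE (A : ℕ) (i : NatExpr) (B k : ℕ) : ℕ → RealExpr
  | 0 => .const 0
  | m + 1 => .add (dotE A i B k m) (.mul (.get A (.add i (.const m))) (.get B (.const (k + m))))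

theorem eval_dotE (A : ℕ) (i : NatExpr) (B k m : ℕ) (s : Memory) :
    (dotE A i B k m).eval s = ∑ j ∈ Finset.range m, s.real A (i.eval s + j) * s.real B (k + j) := by
  induction m with
  | zero => simp [dotE]
  | succ m ih => simp [dotE, ih, Finset.sum_range_succ]

theorem eval_dotE_rowMajor {m m' w : ℕ} {M : Fin m → Fin w → ℝ} {M' : Fin m' → Fin w → ℝ}
    {A B : ℕ} {i : NatExpr} {s : Memory} (r : Fin m) (r' : Fin m') (hA : s.real A = rowMajor M)
    (hB : s.real B = rowMajor M') (hi : i.eval s = r * w) :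
    (dotE A i B (r' * w) w).eval s = M r ⬝ᵥ M' r' := by
  rw [eval_dotE, hA, hB, hi, Finset.sum_range]
  simp only [rowMajor_apply, dotProduct]

/-- The determinant of a matrix with three rows. -/
def detThree (a b c d e f g h i : RealExpr) : RealExpr :=
  .add (.sub (.mul a (.sub (.mul e i) (.mul f h))) (.mul b (.sub (.mul d i) (.mul f g))))
    (.mul c (.sub (.mul d h) (.mul e g)))

/-- The determinant of a matrix with four rows. -/
def detFour (g : Fin 4 → Fin 4 → RealExpr) : RealExpr :=
  .sub (.add (.sub
    (.mul (g 0 0) (detThree (g 1 1) (g 1 2) (g 1 3) (g 2 1) (g 2 2) (g 2 3) (g 3 1) (g 3 2) (g 3 3)))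
    (.mul (g 0 1) (detThree (g 1 0) (g 1 2) (g 1 3) (g 2 0) (g 2 2) (g 2 3) (g 3 0) (g 3 2) (g 3 3))))
    (.mul (g 0 2) (detThree (g 1 0) (g 1 1) (g 1 3) (g 2 0) (g 2 1) (g 2 3) (g 3 0) (g 3 1) (g 3 3))))
    (.mul (g 0 3) (detThree (g 1 0) (g 1 1) (g 1 2) (g 2 0) (g 2 1) (g 2 2) (g 3 0) (g 3 1) (g 3 2)))

theorem eval_detFour (g : Fin 4 → Fin 4 → RealExpr) (s : Memory) :
    (detFour g).eval s = (Matrix.of fun i j => (g i j).eval s).det := by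
  rw [Matrix.det_succ_row_zero]
  simp [detFour, detThree, Matrix.det_fin_three, Fin.sum_univ_four, Fin.succAbove]
  ring

/-- The test whether a number is zero. -/
def isZero (e : RealExpr) : Cond := .and (.not (.realLt e (.const 0))) (.not (.realLt (.const 0) e))

theorem isZero_holds (e : RealExpr) (s : Memory) : (isZero e).Holds s ↔ e.eval s = 0 := by
  simp [isZero, le_antisymm_iff, and_comm]

/-- Compute the four dot products of the current row with the four rows that describe the lines, for
rows of length `w`. -/
def loadRow (w : ℕ) : Program :=
  .seq (.setReal 2 (.get 1 (.const 0)) (dotE 1 (.get 2 (.const 0)) 0 (((0 : Fin 4) : ℕ) * w) w))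
    (.seq (.setReal 3 (.get 1 (.const 0)) (dotE 1 (.get 2 (.const 0)) 0 (((1 : Fin 4) : ℕ) * w) w))
    (.seq (.setReal 4 (.get 1 (.const 0)) (dotE 1 (.get 2 (.const 0)) 0 (((2 : Fin 4) : ℕ) * w) w))
    (.seq (.setReal 5 (.get 1 (.const 0)) (dotE 1 (.get 2 (.const 0)) 0 (((3 : Fin 4) : ℕ) * w) w))
      (.setNat 2 (.const 0) (.add (.get 2 (.const 0)) (.const w))))))

/-- Compute the four dot products for all rows. -/
def loadForms (w : ℕ) : Program :=
  .seq (.setNat 2 (.const 0) (.const 0)) (forLoop 1 (loadRow w))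

/-- The program for the crossing distance between two lines in `ℝ^d`. -/
def crossingDistanceProgram (d : ℕ) : Program :=
  .ite (isZero (detFour fun i j => dotE 0 (.const (i * (d + 1))) 0 (j * (d + 1)) (d + 1)))
    (.setNat 0 (.const 0) (.const 0)) (.seq (loadForms (d + 1)) minimize)

/-- Index expressions have no multiplication, so the row offset `k * w` is maintained by repeated
addition. -/
theorem Spec.loadForms {w n : ℕ} {F : Fin 4 → Fin w → ℝ} {H : Fin n → Fin w → ℝ} {s : Memory}
    (hn : s.nat 0 0 = n) (hF : s.real 0 = rowMajor F) (hH : s.real 1 = rowMajor H) :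
    Spec (RealRAM.loadForms w) s ((n + 1) * ((loadRow w).bound + 12)) fun s' => ∀ i : Fin n,
      s'.real 2 i = H i ⬝ᵥ F 0 ∧ s'.real 3 i = H i ⬝ᵥ F 1 ∧ s'.real 4 i = H i ⬝ᵥ F 2 ∧
        s'.real 5 i = H i ⬝ᵥ F 3 := by
  refine (Spec.seq (Spec.exec rfl (Spec.forLoop (n := n) (T := (loadRow w).bound) (fun k s =>
    (s.real 0 = rowMajor F ∧ s.real 1 = rowMajor H ∧ s.nat 2 0 = k * w) ∧ ∀ i : Fin n, i < k →
      s.real 2 i = H i ⬝ᵥ F 0 ∧ s.real 3 i = H i ⬝ᵥ F 1 ∧ s.real 4 i = H i ⬝ᵥ F 2 ∧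
      s.real 5 i = H i ⬝ᵥ F 3) one_ne_zero ?_ ?_ ?_ ?_ ?_))).mono ?_ ?_
  · simp [loadRow]
  · simp [loadRow]
  · rintro k s hkn h1 h0 ⟨⟨hF, hH, h2⟩, hall⟩
    have e : ∀ r : Fin 4, ∑ j ∈ Finset.range w, s.real 1 (s.nat 2 0 + j) * s.real 0 (r * w + j) =
        H ⟨k, hkn⟩ ⬝ᵥ F r := by
      intro r
      rw [← eval_dotE_rowMajor (i := .get 2 (.const 0)) (⟨k, hkn⟩ : Fin n) r hH hF (by simpa using h2),
        eval_dotE]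
      rfl
    refine Spec.exec rfl ⟨⟨?_, ?_, ?_⟩, fun i hi => ?_⟩
    · simpa [loadRow] using hF
    · simpa [loadRow] using hH
    · simp [loadRow, h2]; ring
    · have ev : ∀ r : Fin 4, ∀ s' : Memory, s'.real 0 = s.real 0 → s'.real 1 = s.real 1 →
          s'.nat 2 = s.nat 2 → (dotE 1 (.get 2 (.const 0)) 0 ((r : ℕ) * w) w).eval s' =
            H ⟨k, hkn⟩ ⬝ᵥ F r := by
        intro r s' e0 e1 e2
        rw [eval_dotE, e0, e1, NatExpr.eval, NatExpr.eval, e2, e]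
      simp only [loadRow, Program.exec]
      rw [ev 0 s rfl rfl rfl, ev 1 (s.setReal 2 _ _), ev 2 ((s.setReal 2 _ _).setReal 3 _ _),
        ev 3 (((s.setReal 2 _ _).setReal 3 _ _).setReal 4 _ _)]
      rotate_left
      iterate 9 simp
      rcases Nat.lt_succ_iff_lt_or_eq.mp hi with hi | hi
      · simpa [h1, Function.update_of_ne hi.ne] using hall i hi
      · obtain rfl : i = ⟨k, hkn⟩ := Fin.ext hi
        simp [h1]
  · simpa using hn
  · simp [hF, hH]
  · simp only [Program.bound, NatExpr.cost]
    ring_nf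
    have : 1 ≤ (loadRow w).bound := by simp [loadRow, Program.bound]; lia
    lia
  · exact fun s' h i => h.2 i i.2

end RealRAM

/-! ### The two complete programs and their asymptotic running time. -/

namespace RealRAM

open Arrangement

theorem clean_input {m n w : ℕ} (F : Fin m → Fin w → ℝ) (H : Fin n → Fin w → ℝ) :
    Clean (input F H) := by
  constructor <;> intro A hA <;> simp only [List.mem_cons, List.not_mem_nil, or_false] at hA
  · rcases hA with rfl | rfl <;> rfl
  · rcases hA with rfl | rfl | rfl | rfl | rfl <;> rfl

theorem Clean.of_writes {P : Program} {s s' : Memory} (hs : Clean s)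
    (hn : ∀ A, A ∉ P.natWrites → s'.nat A = s.nat A)
    (hr : ∀ A, A ∉ P.realWrites → s'.real A = s.real A)
    (h : (∀ A ∈ [7, 12], A ∉ P.natWrites) ∧ ∀ A ∈ [12, 13, 14, 15, 17], A ∉ P.realWrites) :
    Clean s' :=
  ⟨fun A hA => (hn A (h.1 A hA)).trans (hs.1 A hA), fun A hA => (hr A (h.2 A hA)).trans (hs.2 A hA)⟩

/-- A function on `Fin n`, extended by zero. -/
noncomputable def extend {n : ℕ} (f : Fin n → ℝ) (i : ℕ) : ℝ := if h : i < n then f ⟨i, h⟩ else 0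

theorem extend_val {n : ℕ} (f : Fin n → ℝ) (i : Fin n) : extend f i = f i := by
  simp [extend]

theorem Spec.minimize_extend {n : ℕ} {a b c e : Fin n → ℝ} {s : Memory} (hn : s.nat 0 0 = n)
    (h : ∀ i : Fin n, s.real 2 i = a i ∧ s.real 3 i = b i ∧ s.real 4 i = c i ∧ s.real 5 i = e i)
    (hs : Clean s) :
    Spec RealRAM.minimize s ((n + 1) * (Nat.clog 2 n + 1) * 2000) fun s' =>
      IsLeast {m | ∃ x y : ℝ × ℝ, x ≠ 0 ∧ y ≠ 0 ∧
        m = crossCount n (extend a) (extend b) (extend c) (extend e) x y} (s'.nat 0 0) := by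
  refine Spec.minimize hn ?_ ?_ ?_ ?_ hs <;> intro i hi
  · exact (h ⟨i, hi⟩).1.trans (extend_val a ⟨i, hi⟩).symm
  · exact (h ⟨i, hi⟩).2.1.trans (extend_val b ⟨i, hi⟩).symm
  · exact (h ⟨i, hi⟩).2.2.1.trans (extend_val c ⟨i, hi⟩).symm
  · exact (h ⟨i, hi⟩).2.2.2.trans (extend_val e ⟨i, hi⟩).symm

theorem crossingDistanceProgram_spec (d : ℕ) : ∃ C, ∀ (n : ℕ) (H : Fin n → HVec d)
    (u u' v v' : HVec d), LinearIndependent ℝ ![u, u'] → LinearIndependent ℝ ![v, v'] →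
    Outputs (crossingDistanceProgram d) (input ![u, u', v, v'] H) ((n + 1) * (Nat.clog 2 n + 1) * C)
      (crossingDistance H (Submodule.span ℝ {u, u'}) (Submodule.span ℝ {v, v'})) := by
  refine ⟨(isZero (detFour fun i j =>
    dotE 0 (.const (i * (d + 1))) 0 (j * (d + 1)) (d + 1))).cost + 1 +
      ((loadRow (d + 1)).bound + 12 + 2000), fun n H u u' v v' hu hv => ?_⟩
  have hle : ∀ a b t : ℕ, a + ((n + 1) * b + (n + 1) * (t + 1) * 2000) ≤
      (n + 1) * (t + 1) * (a + (b + 2000)) := by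
    intro a b t
    have h1 : a ≤ (n + 1) * (t + 1) * a := Nat.le_mul_of_pos_left _ (by positivity)
    have h2 : (n + 1) * b ≤ (n + 1) * (t + 1) * b :=
      Nat.mul_le_mul_right _ (Nat.le_mul_of_pos_right _ (by positivity))
    rw [mul_add, mul_add]
    lia
  set s := input ![u, u', v, v'] H
  have hF : s.real 0 = rowMajor ![u, u', v, v'] := rfl
  have hH : s.real 1 = rowMajor H := rfl
  have hdet : (isZero (detFour fun i j =>
      dotE 0 (.const (i * (d + 1))) 0 (j * (d + 1)) (d + 1))).Holds s ↔
      ∃ x ∈ Submodule.span ℝ {u, u'}, x ∈ Submodule.span ℝ {v, v'} ∧ x ≠ 0 := by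
    rw [← det_gram_eq_zero_iff hu hv, isZero_holds, eval_detFour]
    have e : (Matrix.of fun i j : Fin 4 =>
        (dotE 0 (.const (i * (d + 1))) 0 (j * (d + 1)) (d + 1)).eval s) =
        Matrix.of ![u, u', v, v'] * (Matrix.of ![u, u', v, v'])ᵀ := by
      ext i j
      exact eval_dotE_rowMajor i j hF hF rfl
    rw [e]
  refine (Spec.ite (fun hc => ?_) fun hc => ?_ : Spec _ s _ _).mono (hle _ _ _) fun _ h => h
  · obtain ⟨x, h1, h2, h3⟩ := hdet.mp hc
    refine (Spec.exec rfl ?_).mono (T := 3) (by nlinarith) fun _ h => h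
    rw [crossingDistance_eq_zero H h1 h2 h3]
    simp
  · rw [hdet] at hc
    push Not at hc
    refine Spec.seq ((Spec.loadForms (n := n) rfl hF hH).frame.mono le_rfl ?_)
    rintro s₁ ⟨h, fn, fr⟩
    refine (Spec.minimize_extend (n := n) ?_ h ?_).mono le_rfl fun s' hs' => ?_
    · rw [fn 0 (by simp [loadForms, loadRow])]
      rfl
    · exact (clean_input _ _).of_writes fn fr (by simp [loadForms, loadRow])
    · exact (crossingDistance_eq hu hv hc (extend_val _) (extend_val _) (extend_val _)
        (extend_val _) hs').symm

/-- The difference of the coordinates `j` of the two points that span the line. -/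
def coordDiff (j : ℕ) : RealExpr := .sub (.get 0 (.const (3 + j))) (.get 0 (.const j))

/-- The value of a linear form that vanishes at the line, at the current data point. -/
def pointForm (j : ℕ) : RealExpr :=
  .sub (.mul (coordDiff 0) (.sub (.get 1 (.add (.get 2 (.const 0)) (.const j))) (.get 0 (.const j))))
    (.mul (coordDiff j) (.sub (.get 1 (.get 2 (.const 0))) (.get 0 (.const 0))))

/-- Compute the linear forms for all data points. -/
def loadPoints : Program :=
  .seq (.setNat 2 (.const 0) (.const 0)) (forLoop 1
    (.seq (.setReal 2 (.get 1 (.const 0)) (pointForm 1))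
    (.seq (.setReal 3 (.get 1 (.const 0)) (pointForm 2))
    (.seq (.setReal 4 (.get 1 (.const 0)) (.get 1 (.get 2 (.const 0))))
    (.seq (.setReal 5 (.get 1 (.const 0)) (.const 1))
      (.setNat 2 (.const 0) (.add (.get 2 (.const 0)) (.const 3))))))))

/-- The program for the regression depth of a line in `ℝ^3`. -/
def regressionDepthProgram : Program :=
  .ite (isZero (coordDiff 0)) (.setNat 0 (.const 0) (.const 0)) (.seq loadPoints minimize)

theorem Spec.loadPoints {n : ℕ} {p q : Fin 3 → ℝ} {pts : Fin n → Fin 3 → ℝ} {s : Memory}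
    (hn : s.nat 0 0 = n) (hF : s.real 0 = rowMajor ![p, q]) (hH : s.real 1 = rowMajor pts) :
    Spec RealRAM.loadPoints s ((n + 1) * 200) fun s' => ∀ i : Fin n,
      s'.real 2 i = (q 0 - p 0) * (pts i 1 - p 1) - (q 1 - p 1) * (pts i 0 - p 0) ∧
      s'.real 3 i = (q 0 - p 0) * (pts i 2 - p 2) - (q 2 - p 2) * (pts i 0 - p 0) ∧
      s'.real 4 i = pts i 0 ∧ s'.real 5 i = 1 := by
  have p0 : rowMajor ![p, q] 0 = p 0 := rowMajor_apply ![p, q] 0 0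
  have p1 : rowMajor ![p, q] 1 = p 1 := rowMajor_apply ![p, q] 0 1
  have p2 : rowMajor ![p, q] 2 = p 2 := rowMajor_apply ![p, q] 0 2
  have q0 : rowMajor ![p, q] 3 = q 0 := rowMajor_apply ![p, q] 1 0
  have q1 : rowMajor ![p, q] 4 = q 1 := rowMajor_apply ![p, q] 1 1
  have q2 : rowMajor ![p, q] 5 = q 2 := rowMajor_apply ![p, q] 1 2
  refine (Spec.seq (Spec.exec rfl (Spec.forLoop (n := n) (T := 150) (fun k s =>
    (s.real 0 = rowMajor ![p, q] ∧ s.real 1 = rowMajor pts ∧ s.nat 2 0 = k * 3) ∧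
      ∀ i : Fin n, i < k →
      s.real 2 i = (q 0 - p 0) * (pts i 1 - p 1) - (q 1 - p 1) * (pts i 0 - p 0) ∧
      s.real 3 i = (q 0 - p 0) * (pts i 2 - p 2) - (q 2 - p 2) * (pts i 0 - p 0) ∧
      s.real 4 i = pts i 0 ∧ s.real 5 i = 1) one_ne_zero (by decide) (by decide) ?_ ?_ ?_))).mono
      ?_ ?_
  · rintro k s hkn h1 h0 ⟨⟨hF, hH, h2⟩, hall⟩
    have x0 : rowMajor pts (k * 3) = pts ⟨k, hkn⟩ 0 := rowMajor_apply pts ⟨k, hkn⟩ 0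
    have x1 : rowMajor pts (k * 3 + 1) = pts ⟨k, hkn⟩ 1 := rowMajor_apply pts ⟨k, hkn⟩ 1
    have x2 : rowMajor pts (k * 3 + 2) = pts ⟨k, hkn⟩ 2 := rowMajor_apply pts ⟨k, hkn⟩ 2
    refine (Spec.exec rfl ⟨⟨?_, ?_, ?_⟩, fun i hi => ?_⟩).mono (by decide) fun _ h => h
    · simpa using hF
    · simpa using hH
    · simp [h2]; ring
    · rcases Nat.lt_succ_iff_lt_or_eq.mp hi with hi | hi
      · simpa [h1, Function.update_of_ne hi.ne] using hall i hi
      · obtain rfl : i = ⟨k, hkn⟩ := Fin.ext hi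
        simp [h1, h2, hF, hH, pointForm, coordDiff, p0, p1, p2, q0, q1, q2, x0, x1, x2]
  · simpa using hn
  · simp [hF, hH]
  · simp only [Program.bound, NatExpr.cost]
    lia
  · exact fun s' h i => h.2 i i.2

theorem regressionDepthProgram_spec {n : ℕ} (pts : Fin n → Fin 3 → ℝ) (p q : Fin 3 → ℝ) :
    Outputs regressionDepthProgram (input ![p, q] pts) ((n + 1) * (Nat.clog 2 n + 1) * 2300)
      (regressionDepth 1 pts (affineSpan ℝ {p, q})) := by
  set s := input ![p, q] pts
  have hF : s.real 0 = rowMajor ![p, q] := rfl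
  have hc : (isZero (coordDiff 0)).Holds s ↔ q 0 - p 0 = 0 := by
    have p0 : rowMajor ![p, q] 0 = p 0 := rowMajor_apply ![p, q] 0 0
    have q0 : rowMajor ![p, q] 3 = q 0 := rowMajor_apply ![p, q] 1 0
    rw [isZero_holds]
    simp [coordDiff, hF, p0, q0]
  have hT : (isZero (coordDiff 0)).cost + 1 +
      ((n + 1) * 200 + (n + 1) * (Nat.clog 2 n + 1) * 2000) ≤
      (n + 1) * (Nat.clog 2 n + 1) * 2300 := by
    simp only [isZero, coordDiff, Cond.cost, RealExpr.cost, NatExpr.cost]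
    ring_nf
    lia
  refine (Spec.ite (fun h => ?_) fun h => ?_ : Spec _ s _ _).mono hT fun _ h => h
  · refine (Spec.exec rfl ?_).mono (T := 3) (by nlinarith) fun _ h => h
    rw [regressionDepth_eq_zero (hc.mp h)]
    simp
  · rw [hc] at h
    refine Spec.seq ((Spec.loadPoints (n := n) rfl hF rfl).frame.mono le_rfl ?_)
    rintro s₁ ⟨hs₁, fn, fr⟩
    refine (Spec.minimize_extend (n := n) ?_ hs₁ ?_).mono le_rfl fun s' hs' => ?_
    · rw [fn 0 (by decide)]
      rfl
    · exact (clean_input _ _).of_writes fn fr (by decide)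
    · exact (regressionDepth_eq h (extend_val _) (extend_val _) (extend_val _) (extend_val _)
        hs').symm

theorem isBigO_clog (C : ℕ) :
    (fun n : ℕ => (((n + 1) * (Nat.clog 2 n + 1) * C : ℕ) : ℝ)) =O[atTop]
      (fun n : ℕ => (n : ℝ) * Real.log n) := by
  -- For `n ≥ 2`, `n + 1 ≤ 2 * n` gives the factor 2. The factor 3 arises from `(clog + 1) * log 2 ≤
  -- log n + 2 * log 2 ≤ 3 * log n`.
  refine IsBigO.of_bound (2 * (3 / Real.log 2) * C) ?_
  filter_upwards [eventually_ge_atTop 2] with n hn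
  have hlog2 : 0 < Real.log 2 := Real.log_pos one_lt_two
  have hn' : (2 : ℝ) ≤ n := by exact_mod_cast hn
  have hlog : Real.log 2 ≤ Real.log n := Real.log_le_log two_pos hn'
  have hclog : (Nat.clog 2 n : ℝ) + 1 ≤ 3 / Real.log 2 * Real.log n := by
    have h1 : (2 : ℝ) ^ (Nat.clog 2 n - 1) ≤ n := by
      exact_mod_cast (Nat.pow_pred_clog_lt_self one_lt_two (by lia)).le
    have h2 := Real.log_le_log (by positivity) h1
    rw [Real.log_pow] at h2
    have h3 : (Nat.clog 2 n : ℝ) ≤ ((Nat.clog 2 n - 1 : ℕ) : ℝ) + 1 := by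
      exact_mod_cast (by lia : Nat.clog 2 n ≤ Nat.clog 2 n - 1 + 1)
    rw [div_mul_eq_mul_div, le_div_iff₀ hlog2]
    nlinarith
  rw [Real.norm_of_nonneg (by positivity), Real.norm_of_nonneg (by positivity)]
  push_cast
  have h1 : (n : ℝ) + 1 ≤ 2 * n := by linarith
  calc ((n : ℝ) + 1) * (Nat.clog 2 n + 1) * C ≤ 2 * n * (3 / Real.log 2 * Real.log n) * C := by
        gcongr
    _ = _ := by ring

end RealRAM

theorem mainTheorem2 :
    (∀ d : ℕ, ∃ (P : RealRAM.Program) (T : ℕ → ℕ),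
      (fun n : ℕ => (T n : ℝ)) =O[atTop] (fun n : ℕ => (n : ℝ) * Real.log n) ∧
      ∀ (n : ℕ) (H : Fin n → Arrangement.HVec d) (u u' v v' : Arrangement.HVec d),
        (∀ i, H i ≠ 0) → LinearIndependent ℝ ![u, u'] → LinearIndependent ℝ ![v, v'] →
        RealRAM.Outputs P (RealRAM.input ![u, u', v, v'] H) (T n)
          (Arrangement.crossingDistance H (Submodule.span ℝ {u, u'}) (Submodule.span ℝ {v, v'}))) ∧
    (∃ (P : RealRAM.Program) (T : ℕ → ℕ),
      (fun n : ℕ => (T n : ℝ)) =O[atTop] (fun n : ℕ => (n : ℝ) * Real.log n) ∧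
      ∀ (n : ℕ) (pts : Fin n → Fin 3 → ℝ) (p q : Fin 3 → ℝ), p ≠ q →
        RealRAM.Outputs P (RealRAM.input ![p, q] pts) (T n)
          (Arrangement.regressionDepth 1 pts (affineSpan ℝ {p, q}))) := by
  refine ⟨fun d => ?_, ?_⟩
  · obtain ⟨C, hC⟩ := RealRAM.crossingDistanceProgram_spec d
    exact ⟨_, _, RealRAM.isBigO_clog C, fun n H u u' v v' _ hu hv => hC n H u u' v v' hu hv⟩
  · exact ⟨_, _, RealRAM.isBigO_clog 2300, fun n pts p q _ =>
      RealRAM.regressionDepthProgram_spec pts p q⟩
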